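/- A turn sequence is a finite word $\sigma=\sigma_1\cdots\sigma_n$ over $\{\mathtt L,\mathtt R\}$. A chain realizes $\sigma$ if it is a simple (non-self-intersecting) rectilinear chain in the plane that starts at the origin $o$, consists of $n+1$ segments of positive integer length, has a first segment heading east (in direction $+x$), and makes the left turns ($\mathtt L$) and right turns ($\mathtt R$) $\sigma_1,\dots,\sigma_n$ in this order. A point $p\in\mathbb Z^2$ is reachable by $\sigma$ if it is the endpoint of some chain that realizes $\sigma$. If some point $(-d,0)$ with $d\ge 1$ is reachable by $\sigma$, let $x^-_\sigma$ denote the least such $d$, the distance from $o$ to the closest reachable point on the $-x$-axis. Let $m(\sigma)$ denote the number of segments in direction $+y$ in the maximal NW-staircase containing the endpoint $p$ of a chain realizing $\sigma$, that is, in the maximal final part of the chain all of whose segments have direction $-x$ or $+y$ (this number depends on $\sigma$ only). **Theorem.** Let $\sigma$ be a turn sequence with $l$ left turns and $r$ right turns, $n=l+r$, and $l-r\ge 0$. If $l-r\ge 3$, then $x^-_\sigma$ exists. Whenever $x^-_\sigma$ exists, it is bounded as follows. - If $l-r=0$, then $x^-_\sigma\le 2$. - If $l-r=1$, then $x^-_\sigma\le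 m(\sigma)+1$. - If $l-r=2$, then $x^-_\sigma\le 2$ if $\sigma_n=\mathtt R$, and $x^-_\sigma\le m(\sigma)+2$ if $\sigma_n=\mathtt L$. - If $l-r\ge 3$, then $x^-_\sigma\le\left\lfloor\frac{l-r+2}{4}\right\rfloor+1$ if $\sigma_n=\mathtt R$ and $l-r\equiv 2\pmod 4$, and $x^-_\sigma\le\left\lfloor\frac{l-r+2}{4}\right\rfloor$ otherwise. -/

import Mathlib

/-- A single turn: left or right. A turn sequence is a `List Turn`. -/
inductive Turn where
  | L : Turn
  | R : Turn
  deriving DecidableEq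

namespace Turn

/-- The direction obtained from `d` by a left turn (rotation by `+90` degrees) or by a right turn
(rotation by `-90` degrees). -/
def apply : Turn → ℤ × ℤ → ℤ × ℤ
  | L, d => (-d.2, d.1)
  | R, d => (d.2, -d.1)

/-- The unit direction of the `i`-th segment (counted from `0`) of a chain that realizes `σ`: the
first segment heads east, and the `i`-th segment comes after the first `i` turns. -/
def heading (σ : List Turn) (i : ℕ) : ℤ × ℤ :=
  (σ.take i).foldl (fun d t => t.apply d) (1, 0)

/-- `v` lists the vertices of a simple rectilinear chain that realizes `σ`. With `n = σ.length`,
the chain starts at `v 0 = o`, bends at `v 1, …, v n`, ends at `v (n + 1)`, and its segments are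
those from `v i` to `v (i + 1)`, `i = 0, …, n`; the values of `v` beyond `n + 1` play no role.

The lattice points of the axis-parallel segment from `v i` to `v (i + 1)` form the (degenerate)
box `Set.uIcc (v i) (v (i + 1))` in `ℤ × ℤ`. Two axis-parallel segments with integral endpoints
that meet in the real plane meet in a lattice point, and they meet in a single point of the plane
if they meet in a single lattice point, so simplicity can be read off from the lattice points. -/
structure IsRealization (σ : List Turn) (v : ℕ → ℤ × ℤ) : Prop where
  /-- The chain starts at the origin. -/
  start : v 0 = (0, 0)
  /-- Each segment has a positive integral length and the direction given by the turns. -/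
  step : ∀ i ≤ σ.length, ∃ t : ℕ, 0 < t ∧ v (i + 1) = v i + (t : ℤ) • heading σ i
  /-- Consecutive segments meet in their common vertex only. -/
  adjacent : ∀ i < σ.length,
    Set.uIcc (v i) (v (i + 1)) ∩ Set.uIcc (v (i + 1)) (v (i + 2)) = {v (i + 1)}
  /-- Segments that are not consecutive do not meet. -/
  nonadjacent : ∀ i j, i + 2 ≤ j → j ≤ σ.length →
    Disjoint (Set.uIcc (v i) (v (i + 1))) (Set.uIcc (v j) (v (j + 1)))

/-- The set `A(σ)` of the points reachable by `σ`. -/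
def reachable (σ : List Turn) : Set (ℤ × ℤ) :=
  {p | ∃ v : ℕ → ℤ × ℤ, IsRealization σ v ∧ v (σ.length + 1) = p}

/-- The distances from the origin to the points on the (open) negative `x`-axis that are reachable
by `σ`. The distance to the closest such point, if there is one, is the least element. -/
def negXDistances (σ : List Turn) : Set ℕ :=
  {d | 0 < d ∧ (-(d : ℤ), 0) ∈ reachable σ}

/-- The number of `+y`-segments in the maximal NW-staircase that contains the endpoint of a chain
realizing `σ`: the last segments of the chain are inspected, from the endpoint backwards, as long
as they head west or north, and those that head north are counted. -/
def nwStaircaseCount (σ : List Turn) : ℕ :=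
  ((((List.range (σ.length + 1)).map (heading σ)).reverse).takeWhile
    (fun d => decide (d = (-1, 0) ∨ d = (0, 1)))).count (0, 1)

end Turn

/-! Let the level of a segment be the number of left turns minus right turns before it; the level
mod 4 is the heading. All the bounds come from explicit drawings. The basic gadget is that a word of
net turning zero can replace a straight segment, because it can be drawn inside a box on that
segment (`Box.exists_of_net`). Cutting a word of net turning k at its successive rises therefore
turns it into a counterclockwise spiral with k left turns whose sides carry boxes.

Each full turn of the spiral costs one column on the left, provided that the descending side does
not bulge to the left of its final column. Cutting at the first rise ensures this, since the piece
before it ends at its own lowest height (`Valley.exists_box`, `spread_of_net`). A word of net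
turning 4j+3, 4j+4 or 4j+5 thus arrives at (-(j+1), 0) from above, from the left or from below. Net
turning 2 mod 4 is reached from a neighboring residue by one more unit step west.

For net turning 0, 1, and 2 with a final left turn, reachability itself has to be used: it forces a
visit to level 3 or -3 (`exists_visit`). The chain can then pass around the origin, unwind on the
left (`draws_of_visit`), and, for net turning 1, finish with the final staircase, each of whose
left-right pairs costs one column (`draws_of_net_one`).

The forced visit is a discrete form of Hopf's Umlaufsatz. A path cut at its point nearest to the
origin on the negative axis closes up along that axis to a simple closed path, whose total turning
is an odd number of full turns by a secant argument (`closed_path_level`). Hence its last level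
before closing is within 1 of a number congruent to 4 mod 8. -/

namespace Turn

/-! ### Chains confined to regions, and their concatenation -/

/-- `Draws w d a b e R`: some simple rectilinear chain with turn sequence `w` starts at `a` with
heading `d`, ends at `b` with heading `e`, and has all its lattice points in `R`. -/
inductive Draws : List Turn → ℤ × ℤ → ℤ × ℤ → ℤ × ℤ → ℤ × ℤ → Set (ℤ × ℤ) → Prop
  | seg {d a b : ℤ × ℤ} {R : Set (ℤ × ℤ)} (k : ℕ) (hk : 0 < k) (hb : b = a + (k : ℤ) • d)
      (hR : Set.uIcc a b ⊆ R) : Draws [] d a b d R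
  | cons {t : Turn} {w : List Turn} {d a b c e : ℤ × ℤ} {R S : Set (ℤ × ℤ)} (k : ℕ) (hk : 0 < k)
      (hb : b = a + (k : ℤ) • d) (hR : Set.uIcc a b ⊆ R) (hS : S ⊆ R)
      (h : Draws w (t.apply d) b c e S) (hd : ∀ p ∈ Set.uIcc a b, p ∈ S → p = b) :
      Draws (t :: w) d a c e R

/-- The turn in the other direction. -/
def flip : Turn → Turn
  | L => R
  | R => L

theorem mem_uIcc_prod {p a b : ℤ × ℤ} :
    p ∈ Set.uIcc a b ↔ (min a.1 b.1 ≤ p.1 ∧ p.1 ≤ max a.1 b.1) ∧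
      (min a.2 b.2 ≤ p.2 ∧ p.2 ≤ max a.2 b.2) := by
  simp only [Set.uIcc, Set.mem_Icc, Prod.le_def, Prod.fst_inf, Prod.snd_inf, Prod.fst_sup,
    Prod.snd_sup]
  tauto

namespace Draws

variable {w w' : List Turn} {d a b c e e' : ℤ × ℤ} {R S : Set (ℤ × ℤ)}

theorem mono (h : Draws w d a b e R) (hRS : R ⊆ S) : Draws w d a b e S := by
  cases h with
  | seg k hk hb hR => exact .seg k hk hb (hR.trans hRS)
  | cons k hk hb hR hS h hd => exact .cons k hk hb (hR.trans hRS) (hS.trans hRS) h hd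

theorem end_mem (h : Draws w d a b e R) : b ∈ R := by
  induction h with
  | seg k hk hb hR => exact hR Set.right_mem_uIcc
  | cons k hk hb hR hS h hd ih => exact hS ih

/-- A chain can be kept inside a bounded box. -/
theorem bounded (h : Draws w d a b e R) :
    ∃ N : ℤ, Draws w d a b e {p | p ∈ R ∧ -N ≤ p.1 ∧ p.1 ≤ N ∧ -N ≤ p.2 ∧ p.2 ≤ N} := by
  have key : ∀ a b : ℤ × ℤ, ∃ N : ℤ, ∀ p ∈ Set.uIcc a b,
      -N ≤ p.1 ∧ p.1 ≤ N ∧ -N ≤ p.2 ∧ p.2 ≤ N := by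
    intro a b
    refine ⟨|a.1| + |b.1| + |a.2| + |b.2|, fun p hp => ?_⟩
    rw [mem_uIcc_prod] at hp
    have h1 := neg_abs_le a.1
    have h2 := le_abs_self a.1
    have h3 := neg_abs_le b.1
    have h4 := le_abs_self b.1
    have h5 := neg_abs_le a.2
    have h6 := le_abs_self a.2
    have h7 := neg_abs_le b.2
    have h8 := le_abs_self b.2
    generalize |a.1| = x1 at *
    generalize |a.2| = x2 at *
    generalize |b.1| = x3 at *
    generalize |b.2| = x4 at *
    refine ⟨?_, ?_, ?_, ?_⟩ <;> omega
  induction h with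
  | @seg d a b R k hk hb hR =>
    obtain ⟨N, hN⟩ := key a b
    exact ⟨N, .seg k hk hb fun p hp => ⟨hR hp, hN p hp⟩⟩
  | @cons t w d a b c e R S k hk hb hR hS h hd ih =>
    obtain ⟨N, hN⟩ := ih
    obtain ⟨M, hM⟩ := key a b
    refine ⟨max N M, .cons k hk hb ?_ ?_ hN ?_⟩
    · intro p hp
      have := hM p hp
      refine ⟨hR hp, ?_⟩
      omega
    · rintro p ⟨hp, h1⟩
      refine ⟨hS hp, ?_⟩
      omega
    · exact fun p hp hp' => hd p hp hp'.1

/-- Two chains that meet only where the second one starts, at a turn. -/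
theorem turn (t : Turn) {d' : ℤ × ℤ} (h : Draws w d a b e R) (h' : Draws w' d' b c e' S)
    (hd' : d' = t.apply e) (hRS : ∀ p ∈ R, p ∈ S → p = b) :
    Draws (w ++ t :: w') d a c e' (R ∪ S) := by
  induction h with
  | seg k hk hb hR =>
    subst hd'
    exact .cons k hk hb (hR.trans Set.subset_union_left) Set.subset_union_right h'
      fun p hp hp' => hRS p (hR hp) hp'
  | @cons t₁ w₁ d₁ a₁ b₁ c₁ e₁ R₁ S₁ k hk hb hR hS h hd ih =>
    refine .cons k hk hb (hR.trans Set.subset_union_left)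
      (Set.union_subset_union_left _ hS) (ih h' hd' fun p hp => hRS p (hS hp)) ?_
    rintro p hp (hp' | hp')
    · exact hd p hp hp'
    · have := hRS p (hR hp) hp'
      exact hd p hp (this ▸ h.end_mem)

/-- A segment of heading `d` in front of a chain of the same heading. -/
theorem extend (k : ℕ) (hk : 0 < k) (hb : b = a + (k : ℤ) • d) (hdir : d.1 = 0 ∨ d.2 = 0)
    (h : Draws w d b c e S) (hRS : ∀ p ∈ Set.uIcc a b, p ∈ S → p = b) :
    Draws w d a c e (Set.uIcc a b ∪ S) := by
  have key : ∀ (k' : ℕ) (b' : ℤ × ℤ), b' = b + (k' : ℤ) • d →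
      Set.uIcc a b' ⊆ Set.uIcc a b ∪ Set.uIcc b b' := by
    intro k' b' hb' p hp
    simp only [Set.mem_union, mem_uIcc_prod] at hp ⊢
    subst hb hb'
    obtain ⟨a1, a2⟩ := a
    obtain ⟨d1, d2⟩ := d
    simp only [Prod.smul_mk, Prod.mk_add_mk, smul_eq_mul] at hp hdir ⊢
    rcases hdir with rfl | rfl
    · simp only [mul_zero, add_zero] at hp ⊢
      generalize (k : ℤ) * d2 = x at *
      generalize (k' : ℤ) * d2 = y at *
      omega
    · simp only [mul_zero, add_zero] at hp ⊢
      generalize (k : ℤ) * d1 = x at *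
      generalize (k' : ℤ) * d1 = y at *
      omega
  cases h with
  | seg k' hk' hb' hR' =>
    refine .seg (k + k') (by omega) ?_
      ((key k' _ hb').trans (Set.union_subset_union_right _ hR'))
    subst hb hb'; push_cast; rw [add_smul, add_assoc]
  | @cons t w _ _ b' _ _ _ S' k' hk' hb' hR' hS' h' hd' =>
    refine .cons (k + k') (by omega) ?_
      ((key k' _ hb').trans (Set.union_subset_union_right _ hR'))
      (hS'.trans Set.subset_union_right) h' ?_
    · subst hb hb'; push_cast; rw [add_smul, add_assoc]
    · intro p hp hp'
      rcases key k' _ hb' hp with h1 | h1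
      · have h2 := hRS p h1 (hS' hp')
        exact hd' p (h2 ▸ Set.left_mem_uIcc) hp'
      · exact hd' p h1 hp'

/-- Two chains that meet only where the second one starts, in the heading of the first one. -/
theorem append {d' : ℤ × ℤ} (h : Draws w d a b e R) (h' : Draws w' d' b c e' S) (hd' : d' = e)
    (hdir : e.1 = 0 ∨ e.2 = 0) (hRS : ∀ p ∈ R, p ∈ S → p = b) :
    Draws (w ++ w') d a c e' (R ∪ S) := by
  induction h with
  | seg k hk hb hR =>
    subst hd'
    exact (extend k hk hb hdir h' fun p hp => hRS p (hR hp)).mono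
      (Set.union_subset_union_left _ hR)
  | @cons t₁ w₁ d₁ a₁ b₁ c₁ e₁ R₁ S₁ k hk hb hR hS h hd ih =>
    refine .cons k hk hb (hR.trans Set.subset_union_left)
      (Set.union_subset_union_left _ hS) (ih h' hd' hdir fun p hp => hRS p (hS hp)) ?_
    rintro p hp (hp' | hp')
    · exact hd p hp hp'
    · have := hRS p (hR hp) hp'
      exact hd p hp (this ▸ h.end_mem)

/-- The quarter turn to the left of a chain. -/
theorem rotate (h : Draws w d a b e R) :
    Draws w (-d.2, d.1) (-a.2, a.1) (-b.2, b.1) (-e.2, e.1) {p | (p.2, -p.1) ∈ R} := by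
  have key : ∀ {a b p : ℤ × ℤ}, p ∈ Set.uIcc ((-a.2, a.1) : ℤ × ℤ) (-b.2, b.1) →
      (p.2, -p.1) ∈ Set.uIcc a b := by
    intro a b p hp
    rw [mem_uIcc_prod] at hp ⊢
    simp only at hp ⊢
    omega
  induction h with
  | seg k hk hb hR =>
    refine .seg k hk ?_ fun p hp => hR (key hp)
    subst hb; exact Prod.ext (by simp; try ring) (by simp; try ring)
  | @cons t₁ w₁ d₁ a₁ b₁ c₁ e₁ R₁ S₁ k hk hb hR hS h hd ih =>
    refine .cons (b := (-b₁.2, b₁.1)) (S := {p | (p.2, -p.1) ∈ S₁}) k hk ?_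
      (fun p hp => hR (key hp)) (fun p hp => hS hp) ?_ ?_
    · subst hb; exact Prod.ext (by simp; try ring) (by simp; try ring)
    · convert ih using 1
      cases t₁ <;> simp [apply]
    · intro p hp hp'
      have := hd _ (key hp) hp'
      rw [← this]; simp

/-- The reflection of a chain in the `x`-axis. -/
theorem reflect (h : Draws w d a b e R) :
    Draws (w.map Turn.flip) (d.1, -d.2) (a.1, -a.2) (b.1, -b.2) (e.1, -e.2)
      {p | (p.1, -p.2) ∈ R} := by
  have key : ∀ {a b p : ℤ × ℤ}, p ∈ Set.uIcc ((a.1, -a.2) : ℤ × ℤ) (b.1, -b.2) →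
      (p.1, -p.2) ∈ Set.uIcc a b := by
    intro a b p hp
    rw [mem_uIcc_prod] at hp ⊢
    simp only at hp ⊢
    omega
  induction h with
  | seg k hk hb hR =>
    refine .seg k hk ?_ fun p hp => hR (key hp)
    subst hb; exact Prod.ext (by simp; try ring) (by simp; try ring)
  | @cons t₁ w₁ d₁ a₁ b₁ c₁ e₁ R₁ S₁ k hk hb hR hS h hd ih =>
    refine .cons (b := (b₁.1, -b₁.2)) (S := {p | (p.1, -p.2) ∈ S₁}) k hk ?_
      (fun p hp => hR (key hp)) (fun p hp => hS hp) ?_ ?_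
    · subst hb; exact Prod.ext (by simp; try ring) (by simp; try ring)
    · convert ih using 1
      cases t₁ <;> simp [apply, Turn.flip]
    · intro p hp hp'
      have := hd _ (key hp) hp'
      rw [← this]; simp

/-- Passage from the recursive description, where only the first segment is compared with the region
of the rest, to the pairwise conditions of `IsRealization`. -/
theorem exists_vertices (h : Draws w d a b e R) (hd0 : d ≠ 0) : ∃ v : ℕ → ℤ × ℤ, v 0 = a ∧
    (∀ i ≤ w.length, ∃ t : ℕ, 0 < t ∧
      v (i + 1) = v i + (t : ℤ) • (w.take i).foldl (fun d t => t.apply d) d) ∧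
    (∀ i < w.length,
      Set.uIcc (v i) (v (i + 1)) ∩ Set.uIcc (v (i + 1)) (v (i + 2)) = {v (i + 1)}) ∧
    (∀ i j, i + 2 ≤ j → j ≤ w.length →
      Disjoint (Set.uIcc (v i) (v (i + 1))) (Set.uIcc (v j) (v (j + 1)))) ∧
    (∀ i ≤ w.length, Set.uIcc (v i) (v (i + 1)) ⊆ R) ∧ v (w.length + 1) = b := by
  induction h with
  | @seg d a b R k hk hb hR =>
    refine ⟨fun i => if i = 0 then a else b, by simp, ?_, by simp, ?_, ?_, by simp⟩
    · intro i hi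
      obtain rfl : i = 0 := by simpa using hi
      exact ⟨k, hk, by simpa using hb⟩
    · intro i j h1 h2
      simp at h2; omega
    · intro i hi
      obtain rfl : i = 0 := by simpa using hi
      simpa using hR
  | @cons t w d a b c e R S k hk hb hR hS h hd ih =>
    have ht0 : t.apply d ≠ 0 := by
      intro h2
      apply hd0
      cases t <;> simp only [apply, Prod.mk_eq_zero, neg_eq_zero] at h2 <;> ext <;> simp [h2.1, h2.2]
    obtain ⟨v, v0, hstep, hadj, hnon, hsub, hend⟩ := ih ht0
    let u : ℕ → ℤ × ℤ := fun i => match i with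
      | 0 => a
      | i + 1 => v i
    have hus : ∀ i, u (i + 1) = v i := fun i => rfl
    have h0 : u 0 = a := rfl
    have h1 : u 1 = b := v0
    refine ⟨u, h0, ?_, ?_, ?_, ?_, hend⟩
    · rintro (_ | i) hi
      · exact ⟨k, hk, by simpa [h0, h1] using hb⟩
      · obtain ⟨s, hs, hv⟩ := hstep i (by simpa using hi)
        exact ⟨s, hs, by simpa [hus] using hv⟩
    · rintro (_ | i) hi
      · ext p
        simp only [Set.mem_inter_iff, Set.mem_singleton_iff]
        rw [h0, show u (0 + 1) = b from h1, show u (0 + 2) = v 1 from rfl]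
        constructor
        · rintro ⟨hp, hp'⟩
          exact hd p hp (hsub 0 (Nat.zero_le _) (by rwa [v0]))
        · rintro rfl
          exact ⟨Set.right_mem_uIcc, Set.left_mem_uIcc⟩
      · exact hadj i (by simpa using hi)
    · rintro (_ | i) (_ | j) hij hj
      · omega
      · rw [h0, show u (0 + 1) = b from h1]
        rw [Set.disjoint_left]
        intro p hp hp'
        have hj' : j ≤ w.length := by simpa using hj
        have hpb := hd p hp (hsub j hj' hp')
        subst hpb
        obtain ⟨j, rfl⟩ : ∃ j', j = j' + 1 := ⟨j - 1, by omega⟩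
        -- The common point is the start of the tail, so it already lies on the tail's first
        -- segment; the tail would then meet itself there.
        rcases Nat.eq_zero_or_pos j with rfl | hj0
        · have := (hadj 0 (by omega)).subset ⟨by rw [v0]; exact Set.left_mem_uIcc, hp'⟩
          rw [Set.mem_singleton_iff] at this
          obtain ⟨s, hs, hv⟩ := hstep 0 (Nat.zero_le _)
          simp only [zero_add] at this hv
          rw [← this, v0] at hv
          have hz : (s : ℤ) • (t.apply d) = 0 := by simpa using hv
          rcases smul_eq_zero.1 hz with h2 | h2
          · omega
          · exact ht0 h2
        · exact Set.disjoint_left.1 (hnon 0 (j + 1) (by omega) hj')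
            (by rw [v0]; exact Set.left_mem_uIcc) hp'
      · omega
      · exact hnon i j (by omega) (by simpa using hj)
    · rintro (_ | i) hi
      · rw [h0, show u (0 + 1) = b from h1]; exact hR
      · exact (hsub i (by simpa using hi)).trans hS

end Draws

/-! ### Net turning and cutting words at levels -/

/-- The number of left turns minus the number of right turns. -/
def net (w : List Turn) : ℤ := (w.count L : ℤ) - w.count R

@[simp] theorem net_nil : net [] = 0 := rfl

@[simp] theorem net_cons_L (w : List Turn) : net (L :: w) = net w + 1 := by
  simp [net]; ring

@[simp] theorem net_cons_R (w : List Turn) : net (R :: w) = net w - 1 := by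
  simp [net]; ring

@[simp] theorem net_append (u v : List Turn) : net (u ++ v) = net u + net v := by
  simp [net]; ring

@[simp] theorem net_map_flip (w : List Turn) : net (w.map flip) = -net w := by
  induction w with
  | nil => rfl
  | cons t w ih => cases t <;> simp [flip, ih] <;> ring

@[simp] theorem map_flip_flip (w : List Turn) : (w.map flip).map flip = w := by
  induction w with
  | nil => rfl
  | cons t w ih => cases t <;> simpa [flip] using ih

/-- The words that return to level `0` without ever rising above it. -/
inductive Valley : List Turn → Prop
  | nil : Valley []
  | cons {u v : List Turn} : net u = 0 → Valley v → Valley (R :: (u ++ L :: v))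

theorem Valley.append {u v : List Turn} (hu : Valley u) (hv : Valley v) : Valley (u ++ v) := by
  induction hu with
  | nil => exact hv
  | @cons u v h _ ih => simpa using Valley.cons h ih

theorem Valley.net_eq {w : List Turn} (h : Valley w) : net w = 0 := by
  induction h with
  | nil => rfl
  | cons hu _ ih => simp [hu, ih]

/-- A word of positive net turning, cut at its first visit to level `1`. -/
theorem exists_first_rise : ∀ (w : List Turn), 1 ≤ net w →
    ∃ a b, w = a ++ L :: b ∧ Valley a ∧ net b = net w - 1 := by
  intro w
  induction hn : w.length using Nat.strong_induction_on generalizing w with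
  | _ n ih =>
    intro h
    match w with
    | [] => simp at h
    | L :: b => exact ⟨[], b, rfl, .nil, by simp⟩
    | R :: w =>
      simp only [net_cons_R, List.length_cons] at h hn
      obtain ⟨a, b, rfl, ha, hb⟩ := ih w.length (by omega) w rfl (by omega)
      obtain ⟨a', b', rfl, ha', hb'⟩ := ih b.length (by simp at hn; omega) b rfl (by omega)
      refine ⟨R :: (a ++ L :: a'), b', by simp, .cons ha.net_eq ha', ?_⟩
      simp only [net_cons_R]
      omega

theorem exists_rise {w : List Turn} (h : 1 ≤ net w) :
    ∃ a b, w = a ++ L :: b ∧ net a = 0 ∧ net b = net w - 1 := by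
  obtain ⟨a, b, h1, h2, h3⟩ := exists_first_rise w h
  exact ⟨a, b, h1, h2.net_eq, h3⟩

theorem exists_fall {w : List Turn} (h : net w ≤ -1) :
    ∃ a b, w = a ++ R :: b ∧ net a = 0 ∧ net b = net w + 1 := by
  obtain ⟨a, b, h1, h2, h3⟩ := exists_rise (w := w.map flip) (by simp; omega)
  refine ⟨a.map flip, b.map flip, ?_, by simp [h2], by simp at h3 ⊢; omega⟩
  have := congrArg (List.map flip) h1
  rw [map_flip_flip] at this
  simpa only [List.map_append, List.map_cons, flip] using this

/-- A word visits each level between `0` and its net turning. -/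
theorem exists_split {w : List Turn} {n : ℤ} (h0 : 0 ≤ n) (h : n ≤ net w) :
    ∃ u v, w = u ++ v ∧ net u = n := by
  induction w generalizing n with
  | nil => exact ⟨[], [], rfl, by simp at h ⊢; omega⟩
  | cons t w ih =>
    rcases h0.eq_or_lt with rfl | h0
    · exact ⟨[], t :: w, rfl, rfl⟩
    · cases t with
      | L =>
        obtain ⟨u, v, rfl, hu⟩ := ih (n := n - 1) (by omega) (by simp at h; omega)
        exact ⟨L :: u, v, rfl, by simp [hu]⟩
      | R =>
        obtain ⟨u, v, rfl, hu⟩ := ih (n := n + 1) (by omega) (by simp at h; omega)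
        exact ⟨R :: u, v, rfl, by simp [hu]⟩

theorem Draws.congr {w : List Turn} {d a b e a' b' : ℤ × ℤ} {R S : Set (ℤ × ℤ)}
    (h : Draws w d a b e R) (ha : a = a') (hb : b = b') (hRS : ∀ x y, (x, y) ∈ R → (x, y) ∈ S) :
    Draws w d a' b' e S := by
  subst ha hb
  exact h.mono fun p hp => hRS p.1 p.2 hp

/-! ### Box drawings of words of net turning zero -/

theorem draws_east {x y k : ℤ} (hk : 0 < k) :
    Draws [] (1, 0) (x, y) (x + k, y) (1, 0) {p | p.2 = y ∧ x ≤ p.1 ∧ p.1 ≤ x + k} := by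
  refine .seg k.toNat (by omega) ?_ fun p hp => ?_
  · ext <;> simp; omega
  · rw [mem_uIcc_prod] at hp
    simp only [Set.mem_ofPred_eq] at hp ⊢
    omega

/-- `w` has a drawing that starts and ends eastward, consisting of a straight part of arbitrary
length, a part of width `X` that stays within distance `D` below and `U` above the starting height,
and a straight part of arbitrary length, at height `Y` above the starting height. -/
def Box (w : List Turn) (X D U Y : ℤ) : Prop :=
  0 < X ∧ 0 ≤ D ∧ 0 ≤ U ∧ -D ≤ Y ∧ Y ≤ U ∧ ∀ x y A B, 0 ≤ A → 0 ≤ B →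
    Draws w (1, 0) (x, y) (x + A + X + B, y + Y) (1, 0)
      {p | (p.2 = y ∧ x ≤ p.1 ∧ p.1 ≤ x + A) ∨
        (x + A < p.1 ∧ p.1 < x + A + X ∧ y - D ≤ p.2 ∧ p.2 ≤ y + U) ∨
        (p.2 = y + Y ∧ x + A + X ≤ p.1 ∧ p.1 ≤ x + A + X + B)}

namespace Box

variable {w : List Turn} {X D U Y : ℤ}

theorem nil : Box [] 1 0 0 0 := by
  refine ⟨by omega, le_rfl, le_rfl, by omega, le_rfl, fun x y A B hA hB => ?_⟩
  refine (draws_east (x := x) (y := y) (k := A + 1 + B) (by omega)).congr rfl (by ext <;> simp; ring) ?_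
  intro p q h
  simp only [Set.mem_ofPred_eq] at h ⊢
  omega

theorem reflect (h : Box w X D U Y) : Box (w.map flip) X U D (-Y) := by
  obtain ⟨hX, hD, hU, hY, hY', h⟩ := h
  refine ⟨hX, hU, hD, by omega, by omega, fun x y A B hA hB => ?_⟩
  refine (h x (-y) A B hA hB).reflect.congr (by simp) (by simp; ring) ?_
  intro p q h
  simp only [Set.mem_ofPred_eq] at h ⊢
  omega

theorem north (h : Box w X D U Y) (x y A B : ℤ) (hA : 0 ≤ A) (hB : 0 ≤ B) :
    Draws w (0, 1) (x, y) (x - Y, y + A + X + B) (0, 1)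
      {p | (p.1 = x ∧ y ≤ p.2 ∧ p.2 ≤ y + A) ∨
        (y + A < p.2 ∧ p.2 < y + A + X ∧ x - U ≤ p.1 ∧ p.1 ≤ x + D) ∨
        (p.1 = x - Y ∧ y + A + X ≤ p.2 ∧ p.2 ≤ y + A + X + B)} := by
  obtain ⟨hX, hD, hU, hY, hY', h⟩ := h
  refine (h y (-x) A B hA hB).rotate.congr (by simp) (by simp; ring) ?_
  intro p q h
  simp only [Set.mem_ofPred_eq] at h ⊢
  omega

theorem west (h : Box w X D U Y) (x y A B : ℤ) (hA : 0 ≤ A) (hB : 0 ≤ B) :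
    Draws w (-1, 0) (x, y) (x - A - X - B, y - Y) (-1, 0)
      {p | (p.2 = y ∧ x - A ≤ p.1 ∧ p.1 ≤ x) ∨
        (x - A - X < p.1 ∧ p.1 < x - A ∧ y - U ≤ p.2 ∧ p.2 ≤ y + D) ∨
        (p.2 = y - Y ∧ x - A - X - B ≤ p.1 ∧ p.1 ≤ x - A - X)} := by
  refine (h.north y (-x) A B hA hB).rotate.congr (by simp) (by simp; ring) ?_
  intro p q h
  simp only [Set.mem_ofPred_eq] at h ⊢
  omega

theorem south (h : Box w X D U Y) (x y A B : ℤ) (hA : 0 ≤ A) (hB : 0 ≤ B) :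
    Draws w (0, -1) (x, y) (x + Y, y - A - X - B) (0, -1)
      {p | (p.1 = x ∧ y - A ≤ p.2 ∧ p.2 ≤ y) ∨
        (y - A - X < p.2 ∧ p.2 < y - A ∧ x - D ≤ p.1 ∧ p.1 ≤ x + U) ∨
        (p.1 = x + Y ∧ y - A - X - B ≤ p.2 ∧ p.2 ≤ y - A - X)} := by
  refine (h.west y (-x) A B hA hB).rotate.congr (by simp) (by simp; ring) ?_
  intro p q h
  simp only [Set.mem_ofPred_eq] at h ⊢
  omega

/-- The word `u` runs south, so its sideways bulges become horizontal and are cleared by the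
paddings `1 + D₁` before it and `U₁ + D₁ + 1` after it. It lowers the path by exactly its width
`X₁`, and `v` continues at that depth. -/
theorem valley {u v : List Turn} {X₁ D₁ U₁ Y₁ X₂ D₂ U₂ Y₂ : ℤ} (hu : Box u X₁ D₁ U₁ Y₁)
    (hv : Box v X₂ D₂ U₂ Y₂) :
    Box (R :: (u ++ L :: v)) (2 + D₁ + Y₁ + U₁ + D₁ + X₂) (X₁ + D₂) U₂ (Y₂ - X₁) := by
  have hu' := hu
  obtain ⟨hX₁, hD₁, hU₁, hY₁, hY₁', -⟩ := hu'
  obtain ⟨hX₂, hD₂, hU₂, hY₂, hY₂', hv⟩ := hv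
  refine ⟨by omega, by omega, by omega, by omega, by omega, fun x y A B hA hB => ?_⟩
  have h1 := draws_east (x := x) (y := y) (k := A + 1 + D₁) (by omega)
  have h2 := hu.south (x + (A + 1 + D₁)) y 0 0 le_rfl le_rfl
  have h3 := hv (x + (A + 1 + D₁) + Y₁) (y - 0 - X₁ - 0) (U₁ + D₁ + 1) B (by omega) hB
  have h4 := h2.turn L h3 rfl (by
    rintro ⟨p, q⟩ hp hq
    simp only [Set.mem_ofPred_eq] at hp hq
    ext <;> simp only <;> omega)
  have h5 := h1.turn R h4 rfl (by
    rintro ⟨p, q⟩ hp hq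
    simp only [Set.mem_ofPred_eq, Set.mem_union] at hp hq
    ext <;> simp only <;> omega)
  refine h5.congr rfl (by ext <;> simp only <;> ring) ?_
  intro p q hp
  simp only [Set.mem_ofPred_eq, Set.mem_union] at hp ⊢
  omega

/-- A word starting with a right turn is cut at a rise back to its starting level, which gives the
form of `valley` with two shorter words; one starting with a left turn is reflected. -/
theorem exists_of_net : ∀ (w : List Turn), net w = 0 → ∃ X D U Y, Box w X D U Y := by
  intro w
  induction hn : w.length using Nat.strong_induction_on generalizing w with
  | _ n ih =>
    have key : ∀ w : List Turn, w.length + 1 = n → net w = 1 →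
        ∃ X D U Y, Box (R :: w) X D U Y := by
      intro w hl hw
      obtain ⟨a, b, rfl, ha, hb⟩ := exists_rise (w := w) (by omega)
      simp only [List.length_append, List.length_cons] at hl
      obtain ⟨_, _, _, _, h1⟩ := ih a.length (by omega) a rfl ha
      obtain ⟨_, _, _, _, h2⟩ := ih b.length (by omega) b rfl (by omega)
      exact ⟨_, _, _, _, h1.valley h2⟩
    intro h
    match w with
    | [] => exact ⟨_, _, _, _, nil⟩
    | R :: w => exact key w (by simpa using hn) (by simp at h; omega)
    | L :: w =>
      obtain ⟨X, D, U, Y, hb⟩ := key (w.map flip) (by simpa using hn) (by simp at h ⊢; omega)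
      have := hb.reflect
      rw [List.map_cons, map_flip_flip] at this
      exact ⟨_, _, _, _, this⟩

end Box

/-- The depth bound equals the final descent, so the drawing never goes below its endpoint: each
block descends monotonically at the scale of boxes, whatever its inner word does. -/
theorem Valley.exists_box (h : Valley w) : ∃ X U Y, Box w X (-Y) U Y := by
  induction h with
  | nil => exact ⟨1, 0, 0, by simpa using Box.nil⟩
  | cons hu _ ih =>
    obtain ⟨X₁, D₁, U₁, Y₁, h1⟩ := Box.exists_of_net _ hu
    obtain ⟨X₂, U₂, Y₂, h2⟩ := ih
    have := h1.valley h2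
    rw [show X₁ + -Y₂ = -(Y₂ - X₁) by ring] at this
    exact ⟨_, _, _, this⟩

/-! ### Counterclockwise spirals -/

/-- Some drawing of `w` stays in the half-plane `-j ≤ x` and ends eastward at its only rightmost
point. -/
def Spread (j : ℤ) (w : List Turn) : Prop :=
  ∃ X Y M, Draws w (1, 0) (0, 0) (X, Y) (1, 0)
    {p | -j ≤ p.1 ∧ -M ≤ p.2 ∧ p.2 ≤ M ∧ (p.1 < X ∨ p.1 = X ∧ p.2 = Y)}

/-- A drawing that passes above everything drawn before, and ends westward at a prescribed
abscissa. -/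
theorem Spread.canopy {j : ℤ} {α β γ : List Turn} (hα : Spread j α) (hβ : net β = 0)
    (hγ : net γ = 0) : ∃ M₀, ∀ M, M₀ ≤ M → ∀ c r h₀, c ≤ r → ∃ h, h₀ ≤ h ∧
      Draws (α ++ L :: (β ++ L :: γ)) (1, 0) (0, 0) (c, h) (-1, 0)
        {p | (-j ≤ p.1 ∧ -M ≤ p.2 ∧ p.2 ≤ M) ∨ (r < p.1 ∧ -M ≤ p.2) ∨ (p.2 = h ∧ c ≤ p.1)} := by
  obtain ⟨X, Y, M₀, hα⟩ := hα
  obtain ⟨Xb, Db, Ub, Yb, hβ⟩ := Box.exists_of_net β hβ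
  obtain ⟨Xc, Dc, Uc, Yc, hγ⟩ := Box.exists_of_net γ hγ
  refine ⟨M₀, fun M hM c r h₀ hc => ?_⟩
  have hend := hα.end_mem
  simp only [Set.mem_ofPred_eq] at hend
  obtain ⟨hXb, hDb, hUb, hYb, hYb', -⟩ := id hβ
  obtain ⟨hXc, hDc, hUc, hYc, hYc', -⟩ := id hγ
  -- `K` puts the rising side so far east that it and the box of `γ` clear both the old drawing and
  -- the abscissa `r`; `A` below lifts the canopy above `M` and `h₀`.
  obtain ⟨K, hK, hK1, hK2⟩ : ∃ K, 0 < K ∧ X < X + K - Ub - Xc ∧ r < X + K - Ub - Xc :=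
    ⟨max 0 (r - X) + Ub + Xc + 1, by omega, by omega, by omega⟩
  obtain ⟨A, hA, hA1, hA2⟩ : ∃ A, 0 ≤ A ∧ h₀ ≤ Y + A - Yc ∧ M < Y + A - Yc :=
    ⟨max 0 (max h₀ (M + 1) - Y + Yc), by omega, by omega, by omega⟩
  have h1 := draws_east (x := X) (y := Y) hK
  have h2 := hα.append h1 rfl (by simp) (by
    rintro ⟨p, q⟩ hp hq
    simp only [Set.mem_ofPred_eq] at hp hq
    ext <;> simp only <;> omega)
  have h3 := hβ.north (X + K) Y A (Uc + 1) hA (by omega)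
  have h4 := hγ.west (X + K - Yb) (Y + A + Xb + (Uc + 1)) 0 (X + K - Yb - Xc - c) le_rfl (by omega)
  have h5 := h3.turn L h4 rfl (by
    rintro ⟨p, q⟩ hp hq
    simp only [Set.mem_ofPred_eq] at hp hq
    ext <;> simp only <;> omega)
  have h6 := h2.turn L h5 rfl (by
    rintro ⟨p, q⟩ hp hq
    simp only [Set.mem_ofPred_eq, Set.mem_union] at hp hq
    ext <;> simp only <;> omega)
  refine ⟨Y + A + Xb + (Uc + 1) - Yc, by omega, ?_⟩
  rw [List.append_nil] at h6
  refine h6.congr rfl (Prod.ext (by ring) rfl) ?_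
  intro p q hp
  simp only [Set.mem_ofPred_eq, Set.mem_union] at hp ⊢
  omega

/-- A drawing that comes down on the left of everything drawn before. -/
theorem Spread.descent {j : ℤ} {α β γ δ : List Turn} {X D U Y : ℤ} (hα : Spread j α)
    (hβ : net β = 0) (hγ : net γ = 0) (hδ : Box δ X D U Y) :
    ∃ M₀, ∀ M, M₀ ≤ M → ∀ e y, e < -j → y ≤ M →
      Draws (α ++ L :: (β ++ L :: (γ ++ L :: δ))) (1, 0) (0, 0) (e, y) (0, -1)
        {p | (-j ≤ p.1 ∧ -M ≤ p.2) ∨ (M < p.2 ∧ e - (D + Y) ≤ p.1) ∨ (p.1 = e ∧ y ≤ p.2)} := by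
  obtain ⟨M₀, h⟩ := hα.canopy hβ hγ
  refine ⟨M₀, fun M hM e y he hy => ?_⟩
  obtain ⟨hX, hD, hU, hY, hY', -⟩ := id hδ
  -- The abscissa `e - Y` compensates the drift of `δ`, so that the descent ends in column `e`. The
  -- height leaves room for the whole box of `δ` above `M`, and the bound on the right keeps the box
  -- of `γ` away from `δ` and inside `-j ≤ x`.
  obtain ⟨h₁, hh, h1⟩ := h M hM (e - Y) (max (e - Y + U) (-j)) (M + 1 + X) (by omega)
  have h2 := hδ.south (e - Y) h₁ 0 (h₁ - X - y) le_rfl (by omega)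
  have h3 := h1.turn L h2 rfl (by
    rintro ⟨p, q⟩ hp hq
    simp only [Set.mem_ofPred_eq] at hp hq
    ext <;> simp only <;> omega)
  rw [show α ++ L :: (β ++ L :: (γ ++ L :: δ)) = α ++ L :: (β ++ L :: γ) ++ L :: δ by simp]
  refine h3.congr rfl (by ext <;> simp only <;> ring) ?_
  intro p q hp
  simp only [Set.mem_ofPred_eq, Set.mem_union] at hp ⊢
  omega

/-- One full turn of the spiral. Since `δ` is a valley, its descent does not leave `-(j + 1) ≤ x`;
the next side passes below everything and is prolonged eastward beyond everything, which restores
the unique rightmost point. -/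
theorem Spread.step {j : ℤ} {α β γ δ ε : List Turn} (hα : Spread j α)
    (hβ : net β = 0) (hγ : net γ = 0) (hδ : Valley δ) (hε : net ε = 0) :
    Spread (j + 1) (α ++ L :: (β ++ L :: (γ ++ L :: (δ ++ L :: ε)))) := by
  obtain ⟨X, U, Y, hδ⟩ := hδ.exists_box
  obtain ⟨X', D', U', Y', hε⟩ := Box.exists_of_net ε hε
  obtain ⟨M₀, h⟩ := hα.descent hβ hγ hδ
  obtain ⟨M, hM, hM0⟩ : ∃ M, M₀ ≤ M ∧ 0 ≤ M := ⟨max M₀ 0, by omega, by omega⟩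
  obtain ⟨hX, hD, hU, hY, hY', hε⟩ := hε
  obtain ⟨N, h1⟩ := (h M hM (-(j + 1)) (-M - 1 - U') (by omega) (by omega)).bounded
  have h2 := hε (-(j + 1)) (-M - 1 - U') 0 (max 0 (N + (j + 1))) le_rfl (by omega)
  have h3 := h1.turn L h2 rfl (by
    rintro ⟨p, q⟩ hp hq
    simp only [Set.mem_ofPred_eq] at hp hq
    ext <;> simp only <;> omega)
  refine ⟨-(j + 1) + 0 + X' + max 0 (N + (j + 1)), -M - 1 - U' + Y', max N (M + 1 + U' + D'), ?_⟩
  rw [show α ++ L :: (β ++ L :: (γ ++ L :: (δ ++ L :: ε))) =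
    α ++ L :: (β ++ L :: (γ ++ L :: δ)) ++ L :: ε by simp]
  refine h3.congr rfl rfl ?_
  intro p q hp
  simp only [Set.mem_ofPred_eq, Set.mem_union] at hp ⊢
  omega

theorem spread_of_net (j : ℕ) : ∀ w : List Turn, net w = 4 * j → Spread j w := by
  induction j with
  | zero =>
    intro w hw
    obtain ⟨X, D, U, Y, hX, hD, hU, hY, hY', h⟩ := Box.exists_of_net w (by simpa using hw)
    refine ⟨X, Y, D + U, (h 0 0 0 0 le_rfl le_rfl).congr rfl (by simp) ?_⟩
    intro p q hp
    simp only [Set.mem_ofPred_eq] at hp ⊢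
    push_cast
    omega
  | succ j ih =>
    intro w hw
    push_cast at hw
    obtain ⟨u, v, rfl, hu⟩ := exists_split (w := w) (n := 4 * j) (by omega) (by omega)
    rw [net_append] at hw
    obtain ⟨a, v, rfl, ha, hv⟩ := exists_rise (w := v) (by omega)
    obtain ⟨b, v, rfl, hb, hv⟩ := exists_rise (w := v) (by omega)
    obtain ⟨c, v, rfl, hc, hv⟩ := exists_rise (w := v) (by omega)
    obtain ⟨d, v, rfl, hd, hv⟩ := exists_first_rise v (by omega)
    have := (ih (u ++ a) (by rw [net_append]; omega)).step hb hc hd (ε := v) (by omega)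
    push_cast
    simpa using this

theorem exists_spread_prefix (j : ℕ) {w : List Turn} (h : 4 * j + 3 ≤ net w) :
    ∃ α β γ δ, w = α ++ L :: (β ++ L :: (γ ++ L :: δ)) ∧ Spread j α ∧ net β = 0 ∧ net γ = 0 ∧
      net δ = net w - 4 * j - 3 := by
  obtain ⟨u, v, rfl, hu⟩ := exists_split (w := w) (n := 4 * j) (by omega) (by omega)
  rw [net_append] at h
  obtain ⟨a, v, rfl, ha, hv⟩ := exists_rise (w := v) (by omega)
  obtain ⟨b, v, rfl, hb, hv⟩ := exists_rise (w := v) (by omega)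
  obtain ⟨c, v, rfl, hc, hv⟩ := exists_rise (w := v) (by omega)
  refine ⟨u ++ a, b, c, v, by simp, spread_of_net j _ (by rw [net_append]; omega), hb, hc, ?_⟩
  rw [net_append]
  omega

/-! ### Arrivals at the negative axis from three sides -/

/-- Arrival from above. -/
theorem draws_south_of_net (j : ℕ) {w : List Turn} (h : net w = 4 * j + 3) {y : ℤ} (hy : y ≤ 0) :
    Draws w (1, 0) (0, 0) (-(j + 1), y) (0, -1)
      {p | -(j : ℤ) ≤ p.1 ∨ 0 < p.2 ∨ p.1 = -(j + 1) ∧ y ≤ p.2} := by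
  obtain ⟨α, β, γ, δ, rfl, hα, hβ, hγ, hδ⟩ := exists_spread_prefix j h.ge
  obtain ⟨X, D, U, Y, hδ⟩ := Box.exists_of_net δ (by omega)
  obtain ⟨M₀, h⟩ := hα.descent hβ hγ hδ
  refine (h (max M₀ 0) (by omega) (-(j + 1)) y (by omega) (by omega)).congr rfl rfl ?_
  intro p q hp
  simp only [Set.mem_ofPred_eq] at hp ⊢
  omega

/-- Arrival from the left. -/
theorem draws_east_of_net (j : ℕ) {w : List Turn} (h : net w = 4 * j + 4) :
    Draws w (1, 0) (0, 0) (-(j + 1), 0) (1, 0) Set.univ := by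
  obtain ⟨α, β, γ, v, rfl, hα, hβ, hγ, hv⟩ := exists_spread_prefix j (w := w) (by omega)
  obtain ⟨δ, ε, rfl, hδ, hε⟩ := exists_rise (w := v) (by omega)
  obtain ⟨X, D, U, Y, hδ⟩ := Box.exists_of_net δ (by omega)
  obtain ⟨X', D', U', Y', hX, hD, hU, hY, hY', hε⟩ := Box.exists_of_net ε (by omega)
  obtain ⟨M₀, h⟩ := hα.descent hβ hγ hδ
  -- The box of `ε`, drawn near the axis to the left of the target, must stay below the part of the
  -- descent above `M`.
  obtain ⟨M, hM, hM0⟩ : ∃ M, M₀ ≤ M ∧ U' + D' ≤ M := ⟨max M₀ (U' + D'), by omega, by omega⟩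
  have h1 := h M hM (-(j + 1) - X') (-Y') (by omega) (by omega)
  have h2 := hε (-(j + 1) - X') (-Y') 0 0 le_rfl le_rfl
  have h3 := h1.turn L h2 rfl (by
    rintro ⟨p, q⟩ hp hq
    simp only [Set.mem_ofPred_eq] at hp hq
    ext <;> simp only <;> omega)
  rw [show α ++ L :: (β ++ L :: (γ ++ L :: (δ ++ L :: ε))) =
    α ++ L :: (β ++ L :: (γ ++ L :: δ)) ++ L :: ε by simp]
  exact h3.congr rfl (by ext <;> simp only <;> ring) fun _ _ _ => trivial

/-- Arrival from below. -/
theorem draws_north_of_net (j : ℕ) {w : List Turn} (h : net w = 4 * j + 5) :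
    Draws w (1, 0) (0, 0) (-(j + 1), 0) (0, 1) {p | ¬ (p.1 = -(j + 2) ∧ p.2 = 0)} := by
  obtain ⟨α, β, γ, v, rfl, hα, hβ, hγ, hv⟩ := exists_spread_prefix j (w := w) (by omega)
  obtain ⟨δ, v, rfl, hδ, hv⟩ := exists_rise (w := v) (by omega)
  obtain ⟨ε, ζ, rfl, hε, hζ⟩ := exists_rise (w := v) (by omega)
  obtain ⟨X, D, U, Y, hδ⟩ := Box.exists_of_net δ (by omega)
  obtain ⟨X', D', U', Y', hε⟩ := Box.exists_of_net ε (by omega)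
  obtain ⟨X₂, D₂, U₂, Y₂, hζ⟩ := Box.exists_of_net ζ (by omega)
  obtain ⟨hX', hD', hU', hY', hY'', hε⟩ := hε
  obtain ⟨hX₂, hD₂, hU₂, hY₂, hY₂', -⟩ := id hζ
  obtain ⟨M₀, h⟩ := hα.descent hβ hγ hδ
  obtain ⟨M, hM, hM0⟩ : ∃ M, M₀ ≤ M ∧ 0 ≤ M := ⟨max M₀ 0, by omega, by omega⟩
  -- `n` compensates the drift of `ζ`, and `y` is so low that its box lies below `-M`. Only the
  -- final straight column of `ζ` then rises to the axis; the descent stays strictly to the left of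
  -- `-(j + 2)`.
  obtain ⟨n, hn⟩ : ∃ n : ℤ, n = -(j + 1) + Y₂ := ⟨_, rfl⟩
  obtain ⟨y, hy⟩ : ∃ y : ℤ, y = -M - 1 - X₂ - U' := ⟨_, rfl⟩
  have h1 := h M hM (n - X' - (U₂ + 1)) y (by omega) (by omega)
  have h2 := hε (n - X' - (U₂ + 1)) y 0 (U₂ + 1) le_rfl (by omega)
  rw [show n - X' - (U₂ + 1) + 0 + X' + (U₂ + 1) = n by ring] at h2
  have h3 := hζ.north n (y + Y') 0 (-(y + Y' + X₂)) le_rfl (by omega)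
  have h4 := h2.turn L h3 rfl (by
    rintro ⟨p, q⟩ hp hq
    simp only [Set.mem_ofPred_eq] at hp hq
    ext <;> simp only <;> omega)
  have h5 := h1.turn L h4 rfl (by
    rintro ⟨p, q⟩ hp hq
    simp only [Set.mem_ofPred_eq, Set.mem_union] at hp hq
    ext <;> simp only <;> omega)
  rw [show α ++ L :: (β ++ L :: (γ ++ L :: (δ ++ L :: (ε ++ L :: ζ)))) =
    α ++ L :: (β ++ L :: (γ ++ L :: δ)) ++ L :: (ε ++ L :: ζ) by simp]
  refine h5.congr rfl (by ext <;> simp only <;> omega) ?_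
  intro p q hp
  simp only [Set.mem_ofPred_eq, Set.mem_union] at hp ⊢
  omega

/-! ### Unwinding on the left of the origin -/

theorem draws_north {x y k : ℤ} (hk : 0 < k) :
    Draws [] (0, 1) (x, y) (x, y + k) (0, 1) {p | p.1 = x ∧ y ≤ p.2 ∧ p.2 ≤ y + k} := by
  refine (draws_east (x := y) (y := -x) hk).rotate.congr (by simp) (by simp) ?_
  intro p q h
  simp only [Set.mem_ofPred_eq] at h ⊢
  omega

theorem draws_west {x y k : ℤ} (hk : 0 < k) :
    Draws [] (-1, 0) (x, y) (x - k, y) (-1, 0) {p | p.2 = y ∧ x - k ≤ p.1 ∧ p.1 ≤ x} := by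
  refine (draws_north (x := y) (y := -x) hk).rotate.congr (by simp) (by simp; ring) ?_
  intro p q h
  simp only [Set.mem_ofPred_eq] at h ⊢
  omega

/-- A word that visits level `3` and returns to level `0` leads to the left of the origin, at any
height, with free space between the last segment and the `x`-axis. -/
theorem draws_of_visit {u v : List Turn} (hu : net u = 3) (hv : net v = -3) {m k : ℤ}
    (hm : -k ≤ m) (hm' : m ≤ k) :
    Draws (u ++ v) (1, 0) (0, 0) (-2, m) (1, 0)
      {p | ¬ (p.1 ≤ -2 ∧ -3 - k ≤ p.1 ∧ -k ≤ p.2 ∧ p.2 ≤ k ∧ p.2 ≠ m)} := by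
  obtain ⟨α, β, γ, δ, rfl, hα, hβ, hγ, hδ⟩ := exists_spread_prefix 0 (w := u) (by simp [hu])
  obtain ⟨a, v, rfl, ha, hv⟩ := exists_fall (w := v) (by omega)
  obtain ⟨b, v, rfl, hb, hv⟩ := exists_fall (w := v) (by omega)
  obtain ⟨c, d, rfl, hc, hd⟩ := exists_fall (w := v) (by omega)
  obtain ⟨Xa, Da, Ua, Ya, hA⟩ := Box.exists_of_net (δ ++ a)
    (by rw [net_append, ha, hδ, hu]; norm_num)
  obtain ⟨Xb, Db, Ub, Yb, hB⟩ := Box.exists_of_net b hb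
  obtain ⟨Xc, Dc, Uc, Yc, hC⟩ := Box.exists_of_net c hc
  obtain ⟨Xd, Dd, Ud, Yd, hXd, hDd, hUd, hYd, hYd', hD⟩ := Box.exists_of_net d (by omega)
  obtain ⟨hXb, hDb, hUb, hYb, hYb', -⟩ := id hB
  obtain ⟨hXc, hDc, hUc, hYc, hYc', -⟩ := id hC
  obtain ⟨M₀, h⟩ := hα.descent hβ hγ hA
  obtain ⟨M, hM, hM0⟩ : ∃ M, M₀ ≤ M ∧ k + Dd + Ud + 1 ≤ M :=
    ⟨max M₀ (k + Dd + Ud + 1), by omega, by omega⟩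
  -- With these choices the boxes of `b` and `c` lie below `-M` and that of `d` to the left of `-3 -
  -- k`, so within the window to be kept free only the straight end of `d`, in row `m`, appears.
  obtain ⟨x, hx⟩ : ∃ x, x = -3 - k - Xd - Uc - Xb - Dc := ⟨_, rfl⟩
  obtain ⟨y, hy⟩ : ∃ y, y = -M - 1 - Xc - Ub - 2 * Db := ⟨_, rfl⟩
  have h1 := h M hM (-1) y (by simp) (by omega)
  have h2 := hB.west (-1) y 0 (-1 - Xb - (x + Yc)) le_rfl (by omega)
  rw [show -1 - 0 - Xb - (-1 - Xb - (x + Yc)) = x + Yc by ring] at h2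
  have h3 := hC.north (x + Yc) (y - Yb) (Ub + Db) (m - Yd - (y - Yb + (Ub + Db) + Xc)) (by omega)
    (by omega)
  rw [show y - Yb + (Ub + Db) + Xc + (m - Yd - (y - Yb + (Ub + Db) + Xc)) = m - Yd by ring,
    show x + Yc - Yc = x by ring] at h3
  have h4 := hD x (m - Yd) 0 (-2 - Xd - x) le_rfl (by omega)
  have h5 := h3.turn R h4 rfl (by
    rintro ⟨p, q⟩ hp hq
    simp only [Set.mem_ofPred_eq] at hp hq
    ext <;> simp only <;> omega)
  have h6 := h2.turn R h5 rfl (by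
    rintro ⟨p, q⟩ hp hq
    simp only [Set.mem_ofPred_eq, Set.mem_union] at hp hq
    ext <;> simp only <;> omega)
  have h7 := h1.turn R h6 rfl (by
    rintro ⟨p, q⟩ hp hq
    simp only [Set.mem_ofPred_eq, Set.mem_union] at hp hq
    ext <;> simp only <;> omega)
  rw [show α ++ L :: (β ++ L :: (γ ++ L :: δ)) ++ (a ++ R :: (b ++ R :: (c ++ R :: d))) =
    α ++ L :: (β ++ L :: (γ ++ L :: (δ ++ a))) ++ R :: (b ++ R :: (c ++ R :: d)) by simp]
  refine h7.congr rfl (by ext <;> simp only <;> ring) ?_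
  intro p q hp
  simp only [Set.mem_ofPred_eq, Set.mem_union] at hp ⊢
  omega

/-! ### Final staircases -/

/-- The word of a staircase that goes north and west. -/
def stairs : ℕ → List Turn
  | 0 => []
  | a + 1 => L :: R :: stairs a

theorem stairs_succ (a : ℕ) : stairs (a + 1) = stairs a ++ [L, R] := by
  induction a with
  | zero => rfl
  | succ a ih =>
    change L :: R :: stairs (a + 1) = (L :: R :: stairs a) ++ [L, R]
    rw [ih]
    rfl

theorem draws_stairs (a : ℕ) : ∀ x y : ℤ, Draws (stairs a) (0, 1) (x, y) (x - a, y + a + 1) (0, 1)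
    {p | x - a ≤ p.1 ∧ p.1 ≤ x ∧ y ≤ p.2 ∧ p.2 ≤ y + a + 1 ∧ (p.2 = y → p.1 = x)} := by
  induction a with
  | zero =>
    intro x y
    refine (draws_north (x := x) (y := y) one_pos).congr rfl (by simp) ?_
    intro p q h
    simp only [Set.mem_ofPred_eq] at h ⊢
    push_cast
    omega
  | succ a ih =>
    intro x y
    have h1 := draws_north (x := x) (y := y) one_pos
    have h2 := draws_west (x := x) (y := y + 1) one_pos
    have h3 := h2.turn R (ih (x - 1) (y + 1)) rfl (by
      rintro ⟨p, q⟩ hp hq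
      simp only [Set.mem_ofPred_eq] at hp hq
      ext <;> simp only <;> omega)
    have h4 := h1.turn L h3 rfl (by
      rintro ⟨p, q⟩ hp hq
      simp only [Set.mem_ofPred_eq, Set.mem_union] at hp hq
      ext <;> simp only <;> omega)
    refine h4.congr rfl (by ext <;> (simp only; push_cast; ring)) ?_
    intro p q hp
    simp only [Set.mem_ofPred_eq, Set.mem_union] at hp ⊢
    push_cast
    omega

/-- Maximality of the stripped staircase is what decides the shape of the remaining end in
`draws_of_net_one`: a last right turn must be preceded by another one. -/
theorem exists_stairs (w : List Turn) :
    ∃ w' a, w = w' ++ stairs a ∧ ∀ w'', w' ≠ w'' ++ [L, R] := by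
  induction hn : w.length using Nat.strong_induction_on generalizing w with
  | _ n ih =>
    by_cases h : ∃ w'', w = w'' ++ [L, R]
    · obtain ⟨w'', rfl⟩ := h
      obtain ⟨w', a, rfl, h'⟩ := ih w''.length (by simp at hn; omega) w'' rfl
      exact ⟨w', a + 1, by simp [stairs_succ], h'⟩
    · exact ⟨w, 0, by simp [stairs], fun w'' hw => h ⟨w'', hw⟩⟩

theorem net_prefix_stairs (a : ℕ) : ∀ u v : List Turn, stairs a = u ++ v →
    0 ≤ net u ∧ net u ≤ 1 := by
  induction a with
  | zero =>
    intro u v h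
    obtain ⟨rfl, -⟩ := List.append_eq_nil_iff.1 h.symm
    simp
  | succ a ih =>
    intro u v h
    match u with
    | [] => simp
    | [t] =>
      obtain ⟨rfl, -⟩ := List.cons.inj h
      simp
    | t :: t' :: u =>
      simp only [stairs, List.cons_append, List.cons.injEq] at h
      obtain ⟨rfl, rfl, h⟩ := h
      simpa using ih u v h

@[simp] theorem net_stairs (a : ℕ) : net (stairs a) = 0 := by
  induction a with
  | zero => rfl
  | succ a ih => simp [stairs, ih]

/-- The unit vector of a heading, numbered by quarter turns. -/
def dir (k : ℤ) : ℤ × ℤ :=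
  if k % 4 = 0 then (1, 0) else if k % 4 = 1 then (0, 1) else if k % 4 = 2 then (-1, 0) else (0, -1)

theorem foldl_dir (w : List Turn) : ∀ k, w.foldl (fun d t => t.apply d) (dir k) = dir (k + net w) := by
  induction w with
  | nil => simp
  | cons t w ih =>
    intro k
    have hk : k % 4 = 0 ∨ k % 4 = 1 ∨ k % 4 = 2 ∨ k % 4 = 3 := by omega
    have h1 : L.apply (dir k) = dir (k + 1) := by
      rcases hk with h | h | h | h <;> simp [dir, h, Int.add_emod, apply]
    have h2 : R.apply (dir k) = dir (k - 1) := by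
      rcases hk with h | h | h | h <;> simp [dir, h, Int.sub_emod, apply]
    rw [List.foldl_cons]
    cases t with
    | L => rw [h1, ih, net_cons_L]; congr 1; ring
    | R => rw [h2, ih, net_cons_R]; congr 1; ring

theorem heading_eq (σ : List Turn) (i : ℕ) : heading σ i = dir (net (σ.take i)) := by
  have := foldl_dir (σ.take i) 0
  rwa [zero_add] at this

theorem nwStaircaseCount_concat (σ : List Turn) (t : Turn) :
    nwStaircaseCount (σ ++ [t]) =
      if dir (net (σ ++ [t])) = (0, 1) then nwStaircaseCount σ + 1
      else if dir (net (σ ++ [t])) = (-1, 0) then nwStaircaseCount σ else 0 := by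
  have h : (List.range (σ.length + 1)).map (heading (σ ++ [t])) =
      (List.range (σ.length + 1)).map (heading σ) := by
    refine List.map_congr_left fun i hi => ?_
    rw [List.mem_range] at hi
    rw [heading, heading, List.take_append_of_le_length (by omega)]
  unfold nwStaircaseCount
  rw [List.length_append, List.length_singleton, List.range_succ, List.map_append, h,
    List.reverse_append]
  simp only [List.map_cons, List.map_nil, List.reverse_cons, List.reverse_nil, List.nil_append,
    List.singleton_append, heading_eq (σ ++ [t])]
  rw [List.take_of_length_le (by simp), List.takeWhile_cons]
  by_cases h1 : dir (net (σ ++ [t])) = (0, 1)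
  · simp [h1, -net_append]
  · by_cases h2 : dir (net (σ ++ [t])) = (-1, 0)
    · simp [h2, -net_append]
    · simp [h1, h2, -net_append]

theorem le_nwStaircaseCount_stairs {w : List Turn} (hw : net w = 1) (a : ℕ) :
    a + 1 ≤ nwStaircaseCount (w ++ stairs a) := by
  induction a with
  | zero =>
    rcases List.eq_nil_or_concat' w with rfl | ⟨w', t, rfl⟩
    · simp at hw
    · simp [stairs, nwStaircaseCount_concat, -net_append, hw, dir]
  | succ a ih =>
    rw [stairs_succ, show w ++ (stairs a ++ [L, R]) = ((w ++ stairs a) ++ [L]) ++ [R] by simp,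
      nwStaircaseCount_concat, nwStaircaseCount_concat]
    simp [hw, dir]
    exact ih

theorem mem_negXDistances {w : List Turn} {d : ℕ} (hd : 0 < d) {e : ℤ × ℤ} {S : Set (ℤ × ℤ)}
    (h : Draws w (1, 0) (0, 0) (-(d : ℤ), 0) e S) : d ∈ negXDistances w := by
  obtain ⟨v, h0, h1, h2, h3, -, h4⟩ := h.exists_vertices (by simp)
  exact ⟨hd, v, ⟨h0, h1, h2, h3⟩, h4⟩

/-- The excluded point is the only new one on the added unit segment. -/
theorem mem_negXDistances_concat {w : List Turn} {d : ℕ} {e : ℤ × ℤ}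
    (h : Draws w (1, 0) (0, 0) (-(d : ℤ), 0) e {p | ¬ (p.1 = -(d + 1) ∧ p.2 = 0)}) {t : Turn}
    (ht : (-1, 0) = t.apply e) : d + 1 ∈ negXDistances (w ++ [t]) := by
  refine mem_negXDistances (Nat.succ_pos d)
    ((h.turn t (draws_west (x := -(d : ℤ)) (y := 0) one_pos) ht ?_).congr rfl ?_ fun _ _ h => h)
  · rintro ⟨p, q⟩ hp hq
    simp only [Set.mem_ofPred_eq] at hp hq
    ext <;> simp only <;> omega
  · exact Prod.ext (by push_cast; ring) rfl

theorem draws_of_net_zero {w : List Turn} (hw : net w = 0)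
    (hvis : ∃ u v, w = u ++ v ∧ (net u = 3 ∨ net u = -3)) {m k : ℤ} (hm : -k ≤ m) (hm' : m ≤ k) :
    Draws w (1, 0) (0, 0) (-2, m) (1, 0)
      {p | ¬ (p.1 ≤ -2 ∧ -3 - k ≤ p.1 ∧ -k ≤ p.2 ∧ p.2 ≤ k ∧ p.2 ≠ m)} := by
  obtain ⟨u, v, rfl, hu | hu⟩ := hvis
  · exact draws_of_visit hu (by rw [net_append] at hw; omega) hm hm'
  · have := (draws_of_visit (u := u.map flip) (v := v.map flip) (m := -m) (k := k) (by simp [hu])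
      (by simp at hw ⊢; omega) (by omega) (by omega)).reflect
    rw [← List.map_append, map_flip_flip] at this
    refine this.congr (by simp) (by simp) ?_
    intro p q h
    simp only [Set.mem_ofPred_eq] at h ⊢
    omega

/-- After stripping the `a` pairs of the staircase, the rest ends either in a left turn after net
turning 0, and is drawn by unwinding, or in two right turns after net turning 3, and is drawn by
arrival from above. Both put the start of the staircase at (-2, -(a+1)), so it ends at (-(a+2), 0),
while at least `a + 1` north segments are counted. -/
theorem draws_of_net_one {w : List Turn} (hw : net w = 1)
    (hvis : ∃ u v, w = u ++ v ∧ (net u = 3 ∨ net u = -3)) :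
    ∃ d : ℕ, 0 < d ∧ d ≤ nwStaircaseCount w + 1 ∧
      Draws w (1, 0) (0, 0) (-(d : ℤ), 0) (0, 1) {p | ¬ (p.1 = -(d + 1) ∧ p.2 = 0)} := by
  obtain ⟨w', a, rfl, hw'⟩ := exists_stairs w
  have hnet : net w' = 1 := by simpa using hw
  refine ⟨a + 2, by omega, by have := le_nwStaircaseCount_stairs hnet a; omega, ?_⟩
  have h1 := draws_stairs a (-2) (-(a + 1))
  rcases List.eq_nil_or_concat' w' with rfl | ⟨ρ, t, rfl⟩
  · simp at hnet
  cases t with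
  | L =>
    have hρ : net ρ = 0 := by simpa using hnet
    -- From the left turn on, only levels 1 and 2 occur, so the visit lies in `ρ`.
    have hvis' : ∃ u v, ρ = u ++ v ∧ (net u = 3 ∨ net u = -3) := by
      obtain ⟨u, v, h, hu⟩ := hvis
      rw [List.append_assoc, List.append_eq_append_iff] at h
      rcases h with ⟨x, rfl, h⟩ | ⟨x, rfl, h⟩
      · match x with
        | [] => exact ⟨ρ, [], by simp, by simpa using hu⟩
        | t :: x =>
          simp only [List.cons_append, List.nil_append, List.cons.injEq] at h
          obtain ⟨rfl, h⟩ := h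
          have := net_prefix_stairs a x v h
          rw [net_append, net_cons_L] at hu
          omega
      · exact ⟨u, x, rfl, hu⟩
    have h2 := draws_of_net_zero hρ hvis' (m := -(a + 1)) (k := a + 1) (by omega) (by omega)
    have h3 := h2.turn L h1 rfl (by
      rintro ⟨p, q⟩ hp hq
      simp only [Set.mem_ofPred_eq] at hp hq
      ext <;> simp only <;> omega)
    rw [List.append_assoc]
    refine h3.congr rfl (by ext <;> (simp only; push_cast; ring)) ?_
    intro p q hp
    simp only [Set.mem_ofPred_eq, Set.mem_union] at hp ⊢
    push_cast
    omega
  | R =>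
    rcases List.eq_nil_or_concat' ρ with rfl | ⟨ρ, t, rfl⟩
    · simp at hnet
    cases t with
    | L => exact absurd (by simp) (hw' ρ)
    | R =>
      have h2 := draws_south_of_net 0 (w := ρ) (y := -(a + 1)) (by simp at hnet ⊢; omega)
        (by omega)
      have h3 := draws_west (x := -1) (y := -(a + 1)) one_pos
      have h4 := h3.turn R h1 rfl (by
        rintro ⟨p, q⟩ hp hq
        simp only [Set.mem_ofPred_eq] at hp hq
        ext <;> simp only <;> omega)
      have h5 := h2.turn R h4 rfl (by
        rintro ⟨p, q⟩ hp hq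
        simp only [Set.mem_ofPred_eq, Set.mem_union] at hp hq
        push_cast at hp
        ext <;> simp only <;> omega)
      rw [show ρ ++ [R] ++ [R] ++ stairs a = ρ ++ R :: ([] ++ R :: stairs a) by simp]
      refine h5.congr rfl (by ext <;> (simp only; push_cast; ring)) ?_
      intro p q hp
      simp only [Set.mem_ofPred_eq, Set.mem_union] at hp ⊢
      push_cast at hp ⊢
      omega

/-! ### Octants, secants and the turning of closed lattice paths -/

/-- The number of the open quadrant or half-axis of a nonzero vector, counterclockwise from
east. -/
def octant (p : ℤ × ℤ) : ℤ :=
  if p.2 = 0 then (if 0 < p.1 then 0 else 4)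
  else if 0 < p.2 then (if 0 < p.1 then 1 else if p.1 = 0 then 2 else 3)
  else (if p.1 < 0 then 5 else if p.1 = 0 then 6 else 7)

theorem octant_spec (p : ℤ × ℤ) :
    (p.2 = 0 ∧ 0 < p.1 ∧ octant p = 0) ∨ (p.2 = 0 ∧ p.1 ≤ 0 ∧ octant p = 4) ∨
    (0 < p.2 ∧ 0 < p.1 ∧ octant p = 1) ∨ (0 < p.2 ∧ p.1 = 0 ∧ octant p = 2) ∨
    (0 < p.2 ∧ p.1 < 0 ∧ octant p = 3) ∨ (p.2 < 0 ∧ p.1 < 0 ∧ octant p = 5) ∨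
    (p.2 < 0 ∧ p.1 = 0 ∧ octant p = 6) ∨ (p.2 < 0 ∧ 0 < p.1 ∧ octant p = 7) := by
  unfold octant
  split_ifs <;> omega

theorem dir_spec (k : ℤ) :
    (k % 4 = 0 ∧ (dir k).1 = 1 ∧ (dir k).2 = 0) ∨ (k % 4 = 1 ∧ (dir k).1 = 0 ∧ (dir k).2 = 1) ∨
    (k % 4 = 2 ∧ (dir k).1 = -1 ∧ (dir k).2 = 0) ∨
    (k % 4 = 3 ∧ (dir k).1 = 0 ∧ (dir k).2 = -1) := by
  unfold dir
  split_ifs with h1 h2 h3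
  · exact Or.inl ⟨h1, rfl, rfl⟩
  · exact Or.inr (Or.inl ⟨h2, rfl, rfl⟩)
  · exact Or.inr (Or.inr (Or.inl ⟨h3, rfl, rfl⟩))
  · exact Or.inr (Or.inr (Or.inr ⟨by omega, rfl, rfl⟩))

/-- The change of the octant from one vector to a neighboring one, as a number in `{-1, 0, 1}`. -/
def octantChange (p q : ℤ × ℤ) : ℤ := (octant q - octant p + 1) % 8 - 1

theorem octantChange_emod (p q : ℤ × ℤ) : (octant p + octantChange p q) % 8 = octant q % 8 := by
  unfold octantChange
  omega

/-- A unit lattice step between nonzero vectors cannot cross a half-axis without landing on it. -/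
theorem octantChange_bound {p q : ℤ × ℤ} (hp : p ≠ 0) (hq : q ≠ 0)
    (k : ℤ) (h : q = p + dir k ∨ p = q + dir k) : -1 ≤ octantChange p q ∧ octantChange p q ≤ 1 := by
  have hp' : ¬ (p.1 = 0 ∧ p.2 = 0) := fun h => hp (Prod.ext h.1 h.2)
  have hq' : ¬ (q.1 = 0 ∧ q.2 = 0) := fun h => hq (Prod.ext h.1 h.2)
  have h' : (q.1 = p.1 + (dir k).1 ∧ q.2 = p.2 + (dir k).2) ∨
      (p.1 = q.1 + (dir k).1 ∧ p.2 = q.2 + (dir k).2) := by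
    rcases h with rfl | rfl <;> simp
  unfold octantChange
  have h1 := octant_spec p
  have h2 := octant_spec q
  have h3 := dir_spec k
  rcases h1 with ⟨a, b, c⟩ | ⟨a, b, c⟩ | ⟨a, b, c⟩ | ⟨a, b, c⟩ | ⟨a, b, c⟩ | ⟨a, b, c⟩ | ⟨a, b, c⟩ |
    ⟨a, b, c⟩ <;> rw [c] <;> omega

theorem octant_neg {p : ℤ × ℤ} (hp : p ≠ 0) : octant (-p) % 8 = (octant p + 4) % 8 := by
  have hp' : ¬ (p.1 = 0 ∧ p.2 = 0) := fun h => hp (Prod.ext h.1 h.2)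
  have h1 := octant_spec p
  have h2 := octant_spec (-p)
  simp only [Prod.fst_neg, Prod.snd_neg] at h2
  omega

theorem octant_dir (k : ℤ) : octant (dir k) % 8 = 2 * k % 8 := by
  have h1 := octant_spec (dir k)
  have h2 := dir_spec k
  omega

theorem octantChange_dir {k l : ℤ} (h1 : l ≤ k + 1) (h2 : k ≤ l + 1) :
    octantChange (dir k) (dir k + dir l) = l - k := by
  have h3 := octant_spec (dir k)
  have h4 := octant_spec (dir k + dir l)
  have h5 := dir_spec k
  have h6 := dir_spec l
  simp only [Prod.fst_add, Prod.snd_add] at h4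
  unfold octantChange
  rcases h5 with ⟨a, b, c⟩ | ⟨a, b, c⟩ | ⟨a, b, c⟩ | ⟨a, b, c⟩ <;> rw [b, c] at h3 h4 <;> omega

section Secants

variable (u : ℕ → ℤ × ℤ) (lev : ℕ → ℤ)

/-- A continuous choice of the octant of the secant from `u i` to `u (i + 1 + n)`, counted in such
a way that it is twice the level for `n = 0`. -/
def secant (i : ℕ) : ℕ → ℤ
  | 0 => 2 * lev i
  | n + 1 => secant i n + octantChange (u (i + 1 + n) - u i) (u (i + 1 + (n + 1)) - u i)

variable {u lev} {M : ℕ} (hstep : ∀ i < M, u (i + 1) = u i + dir (lev i))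
  (hinj : ∀ i j, i < j → j ≤ M → ¬ (i = 0 ∧ j = M) → u j - u i ≠ 0)

include hstep in
theorem secant_emod (i n : ℕ) (h : i + 1 + n ≤ M) :
    secant u lev i n % 8 = octant (u (i + 1 + n) - u i) % 8 := by
  induction n with
  | zero =>
    rw [secant, add_zero, hstep i (by omega), add_sub_cancel_left, octant_dir]
  | succ n ih =>
    rw [secant, ← octantChange_emod (u (i + 1 + n) - u i)]
    have := ih (by omega)
    omega

include hstep hinj

theorem secant_succ_bound (i n : ℕ) (h : i + 1 + (n + 1) ≤ M) (h' : ¬ (i = 0 ∧ n + 2 = M)) :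
    secant u lev i (n + 1) - secant u lev i n ≤ 1 ∧
      -1 ≤ secant u lev i (n + 1) - secant u lev i n := by
  have := octantChange_bound (hinj i (i + 1 + n) (by omega) (by omega) (by omega))
    (hinj i (i + 1 + (n + 1)) (by omega) h (by omega)) (lev (i + 1 + n))
    (Or.inl (by rw [← add_assoc, hstep _ (by omega)]; abel))
  rw [secant]
  omega

/-- The lifts for different initial points are compatible. Moving the common endpoint of two
neighboring secants changes each lift by at most 1, so their difference stays at most 3 in absolute
value; its residue mod 8 is that of a change of at most 1, which determines it. -/
theorem secant_shift_bound (hturn : ∀ i, i + 1 < M → lev (i + 1) ≤ lev i + 1 ∧ lev i ≤ lev (i + 1) + 1)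
    (i n : ℕ) (h : i + 2 + n ≤ M) (h' : ¬ (i = 0 ∧ n + 2 = M)) :
    secant u lev (i + 1) n - secant u lev i (n + 1) ≤ 1 ∧
      -1 ≤ secant u lev (i + 1) n - secant u lev i (n + 1) := by
  induction n with
  | zero =>
    have ht := hturn i (by omega)
    have h1 := hstep i (by omega)
    have h2 := hstep (i + 1) (by omega)
    have h3 : octantChange (u (i + 1 + 0) - u i) (u (i + 1 + (0 + 1)) - u i) =
        lev (i + 1) - lev i := by
      rw [← octantChange_dir ht.1 ht.2]
      congr 1
      · rw [add_zero, h1]; abel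
      · rw [zero_add, h2, h1]; abel
    simp only [secant]
    rw [h3]
    omega
  | succ n ih =>
    have ih := ih (by omega) (by omega)
    have h1 := secant_succ_bound hstep hinj (i + 1) n (by omega) (by omega)
    have h2 := secant_succ_bound hstep hinj i (n + 1) (by omega) (by omega)
    have h3 := secant_emod hstep (i + 1) (n + 1) (by omega)
    have h4 := secant_emod hstep i (n + 1 + 1) (by omega)
    rw [show i + 1 + 1 + (n + 1) = i + n + 3 by ring] at h3
    rw [show i + 1 + (n + 1 + 1) = i + n + 3 by ring] at h4
    have h5 := octantChange_bound (p := u (i + n + 3) - u i) (q := u (i + n + 3) - u (i + 1))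
      (hinj _ _ (by omega) (by omega) (by omega)) (hinj _ _ (by omega) (by omega) (by omega))
      (lev i) (Or.inr (by rw [hstep i (by omega)]; abel))
    have h6 := octantChange_emod (u (i + n + 3) - u i) (u (i + n + 3) - u (i + 1))
    omega

/-- The total turning of a closed simple lattice path is an odd number of full turns. -/
theorem closed_path_level
    (hturn : ∀ i, i + 1 < M → lev (i + 1) ≤ lev i + 1 ∧ lev i ≤ lev (i + 1) + 1)
    (hM : 3 ≤ M) (hclosed : u M = u 0) (h0 : lev 0 = 0) (hlast : u (M - 1) = u 0 + (-1, 0)) :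
    lev (M - 1) % 8 = 4 := by
  -- At the same vertex, the secant to the end of the closed path is opposite to the secant from its
  -- start. The two lifts thus move by equal amounts mod 8, and by small amounts, so their
  -- difference is constant.
  have hconst : ∀ n, n + 2 ≤ M → secant u lev (n + 1) (M - 2 - n) - secant u lev 0 n =
      secant u lev 1 (M - 2) - secant u lev 0 0 := by
    intro n
    induction n with
    | zero => intro _; rfl
    | succ n ih =>
      intro hn
      have ih := ih (by omega)
      obtain ⟨r, hr⟩ : ∃ r, M - 2 - n = r + 1 := ⟨M - 3 - n, by omega⟩
      rw [show M - 2 - (n + 1) = r by omega]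
      rw [hr] at ih
      have h1 := secant_shift_bound hstep hinj hturn (n + 1) r (by omega) (by omega)
      have h2 := secant_succ_bound hstep hinj 0 n (by omega) (by omega)
      have h3 := secant_emod hstep (n + 1 + 1) r (by omega)
      have h4 := secant_emod hstep (n + 1) (r + 1) (by omega)
      have h5 := secant_emod hstep 0 (n + 1) (by omega)
      have h6 := secant_emod hstep 0 n (by omega)
      rw [show n + 1 + 1 + 1 + r = M by omega, hclosed] at h3
      rw [show n + 1 + 1 + (r + 1) = M by omega, hclosed] at h4
      rw [show 0 + 1 + (n + 1) = n + 1 + 1 by ring] at h5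
      rw [show 0 + 1 + n = n + 1 by ring] at h6
      have h7 := octant_neg (hinj 0 (n + 1 + 1) (by omega) (by omega) (by omega))
      have h8 := octant_neg (hinj 0 (n + 1) (by omega) (by omega) (by omega))
      rw [neg_sub] at h7 h8
      omega
  have h1 := hconst (M - 2) (by omega)
  rw [show M - 2 + 1 = M - 1 by omega, show M - 2 - (M - 2) = 0 by omega] at h1
  obtain ⟨r, rfl⟩ : ∃ r, M = r + 3 := ⟨M - 3, by omega⟩
  -- The secants from the start to the last vertex and from the second vertex to the end both point
  -- west, and their lifts differ by at most 2, hence agree. By `h1`, twice the last level is the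
  -- sum of these lifts, so the level equals the common lift, which is 4 mod 8.
  have h2 := secant_shift_bound hstep hinj hturn 0 r (by omega) (by omega)
  have h3 := secant_succ_bound hstep hinj 1 r (by omega) (by omega)
  have h4 := secant_emod hstep 1 (r + 1) (by omega)
  have h5 := secant_emod hstep 0 (r + 1) (by omega)
  rw [show 1 + 1 + (r + 1) = r + 3 by ring, hclosed, hstep 0 (by omega), h0,
    sub_add_cancel_left] at h4
  rw [show 0 + 1 + (r + 1) = r + 3 - 1 by omega, hlast, add_sub_cancel_left] at h5
  have h6 : octant ((-1, 0) : ℤ × ℤ) = 4 := by decide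
  have h7 : octant (-dir 0) = 4 := by decide
  rw [h6] at h5
  rw [h7] at h4
  simp only [secant, h0, show r + 3 - 2 = r + 1 by omega, zero_add] at h1 h2 h3 h4 h5
  omega

end Secants

/-! ### Simple lattice paths that end on the negative axis -/

/-- `u 0, …, u N` is a simple lattice path from the origin, and its `i`-th step has level `lev i`;
the first step goes east. -/
structure LatticePath (N : ℕ) (u : ℕ → ℤ × ℤ) (lev : ℕ → ℤ) : Prop where
  pos : 0 < N
  start : u 0 = 0
  lev_zero : lev 0 = 0
  step : ∀ i < N, u (i + 1) = u i + dir (lev i)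
  turn : ∀ i, i + 1 < N → lev (i + 1) ≤ lev i + 1 ∧ lev i ≤ lev (i + 1) + 1
  inj : ∀ i j, i < j → j ≤ N → u i ≠ u j

namespace LatticePath

variable {N : ℕ} {u : ℕ → ℤ × ℤ} {lev : ℕ → ℤ}

theorem extend (h : LatticePath N u lev) {k : ℤ} (h1 : k ≤ lev (N - 1) + 1)
    (h2 : lev (N - 1) ≤ k + 1) (t : ℕ)
    (hnew : ∀ s : ℕ, 0 < s → s ≤ t → ∀ i ≤ N, u i ≠ u N + (s : ℤ) • dir k) :
    ∃ u' lev', LatticePath (N + t) u' lev' ∧ (∀ i ≤ N, u' i = u i) ∧ (∀ i < N, lev' i = lev i) ∧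
      (∀ s : ℕ, u' (N + s) = u N + (s : ℤ) • dir k) ∧ (∀ s : ℕ, lev' (N + s) = k) := by
  have hu : ∀ s : ℕ, (if N + s ≤ N then u (N + s) else u N + ((N + s - N : ℕ) : ℤ) • dir k) =
      u N + (s : ℤ) • dir k := by
    intro s
    rcases Nat.eq_zero_or_pos s with rfl | hs
    · simp
    · simp [show s ≠ 0 by omega]
  have hdir : dir k ≠ 0 := by
    intro h
    have h1 := dir_spec k
    rw [h] at h1
    simp at h1
  refine ⟨fun i => if i ≤ N then u i else u N + ((i - N : ℕ) : ℤ) • dir k,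
    fun i => if i < N then lev i else k, ⟨by have := h.pos; omega, ?_, ?_, ?_, ?_, ?_⟩,
    fun i hi => by simp [hi], fun i hi => by simp [hi], hu, fun s => by simp⟩
  · simpa using h.start
  · simpa [h.pos] using h.lev_zero
  · intro i hi
    rcases lt_or_ge i N with hiN | hiN
    · simpa [hiN, hiN.le, Nat.succ_le_of_lt hiN] using h.step i hiN
    · obtain ⟨s, rfl⟩ := Nat.exists_eq_add_of_le hiN
      rw [add_assoc, hu, hu]
      simp only [show ¬ N + s < N by omega, if_false]
      push_cast
      rw [add_smul, one_smul, add_assoc]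
  · intro i hi
    rcases lt_trichotomy (i + 1) N with hiN | hiN | hiN
    · simpa [hiN, show i < N by omega] using h.turn i hiN
    · subst hiN
      simpa using ⟨h1, h2⟩
    · simp [show ¬ i < N by omega, show ¬ i + 1 < N by omega]
  · intro i j hij hj
    rcases le_or_gt j N with hjN | hjN
    · simpa [hjN, show i ≤ N by omega] using h.inj i j hij hjN
    · obtain ⟨s, rfl⟩ := Nat.exists_eq_add_of_le hjN.le
      rw [hu]
      rcases le_or_gt i N with hiN | hiN
      · simpa [hiN] using hnew s (by omega) (by omega) i hiN
      · obtain ⟨r, rfl⟩ := Nat.exists_eq_add_of_le hiN.le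
        rw [hu]
        intro he
        rw [add_right_inj, ← sub_eq_zero, ← sub_smul, smul_eq_zero] at he
        rcases he with he | he
        · omega
        · exact hdir he

/-- One more step east closes the path at the origin, so `closed_path_level` applies. -/
theorem level_of_end (h : LatticePath N u lev) (hN : u N = (-1, 0)) {k : ℤ} (hk : k % 4 = 0)
    (h1 : k ≤ lev (N - 1) + 1) (h2 : lev (N - 1) ≤ k + 1) : k % 8 = 4 := by
  have hpos := h.pos
  have hN2 : 2 ≤ N := by
    by_contra hlt
    obtain rfl : N = 1 := by omega
    have := h.step 0 one_pos
    rw [h.start, h.lev_zero] at this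
    rw [zero_add] at this
    rw [this] at hN
    exact absurd hN (by decide)
  have hdk : dir k = (1, 0) := by simp [dir, hk]
  have key := closed_path_level (u := fun i => if i ≤ N then u i else 0)
    (lev := fun i => if i < N then lev i else k) (M := N + 1) ?_ ?_ ?_ (by omega) ?_ ?_ ?_
  · simpa using key
  · intro i hi
    rcases lt_or_eq_of_le (Nat.le_of_lt_succ hi) with hi | rfl
    · simpa [hi, hi.le, Nat.succ_le_of_lt hi] using h.step i hi
    · simp [hN, hdk]
      rfl
  · intro i j hij hj hne
    rcases lt_or_eq_of_le hj with hj | rfl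
    · have hjN : j ≤ N := by omega
      simpa [hjN, show i ≤ N by omega, sub_eq_zero] using (h.inj i j hij hjN).symm
    · have := h.inj 0 i (by omega) (by omega)
      rw [h.start] at this
      simpa [show i ≤ N by omega] using this.symm
  · intro i hi
    rcases lt_or_eq_of_le (Nat.le_of_lt_succ hi) with hi | hi
    · simpa [hi, show i < N by omega] using h.turn i hi
    · subst hi
      simpa using ⟨h1, h2⟩
  · simp [h.start]
  · simpa [hpos] using h.lev_zero
  · simp [hN, h.start]

/-- A simple lattice path to the negative `x`-axis visits a level of absolute value at least
`3`. -/
theorem exists_level (h : LatticePath N u lev) {d : ℕ} (hd : 0 < d) (hend : u N = (-(d : ℤ), 0)) :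
    ∃ i < N, 3 ≤ lev i ∨ lev i ≤ -3 := by
  classical
  have hex : ∃ e : ℕ, 0 < e ∧ ∃ i ≤ N, u i = (-(e : ℤ), 0) := ⟨d, hd, N, le_rfl, hend⟩
  obtain ⟨he, i, hi, hui⟩ := Nat.find_spec hex
  have hmin : ∀ e' < Nat.find hex, 0 < e' → ∀ i ≤ N, u i ≠ (-(e' : ℤ), 0) :=
    fun e' he' h0 i hi h => Nat.find_min hex he' ⟨h0, i, hi, h⟩
  generalize Nat.find hex = e at he hui hmin
  have hi0 : 0 < i := by
    rcases Nat.eq_zero_or_pos i with rfl | hi0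
    · rw [h.start] at hui
      have := congrArg Prod.fst hui
      simp at this
      omega
    · exact hi0
  have hpath : LatticePath i u lev := ⟨hi0, h.start, h.lev_zero, fun j hj => h.step j (by omega),
    fun j hj => h.turn j (by omega), fun j k hjk hk => h.inj j k hjk (by omega)⟩
  have hstep := h.step (i - 1) (by omega)
  rw [show i - 1 + 1 = i by omega, hui] at hstep
  have hs1 := congrArg Prod.fst hstep
  have hs2 := congrArg Prod.snd hstep
  simp only [Prod.fst_add, Prod.snd_add] at hs1 hs2
  have hspec := dir_spec (lev (i - 1))
  -- A westward last step would come from a nearer point of the negative axis or from the origin;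
  -- the latter is only the start, which is left eastward.
  have hwest : lev (i - 1) % 4 ≠ 2 := by
    intro hw
    have hui' : u (i - 1) = (-((e - 1 : ℕ) : ℤ), 0) := by
      refine Prod.ext ?_ ?_ <;> simp only <;> omega
    rcases Nat.eq_zero_or_pos (e - 1) with h0 | h0
    · rw [h0] at hui'
      rcases Nat.eq_zero_or_pos (i - 1) with h3 | h3
      · rw [h3, h.lev_zero] at hw
        omega
      · refine h.inj 0 (i - 1) h3 (by omega) ?_
        rw [h.start, hui']
        rfl
    · exact hmin (e - 1) (by omega) h0 (i - 1) (by omega) hui'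
  obtain ⟨k, hk, h1, h2⟩ : ∃ k, k % 4 = 0 ∧ k ≤ lev (i - 1) + 1 ∧ lev (i - 1) ≤ k + 1 := by
    rcases hspec with ⟨h3, -⟩ | ⟨h3, -⟩ | ⟨h3, -⟩ | ⟨h3, -⟩
    · exact ⟨lev (i - 1), by omega, by omega, by omega⟩
    · exact ⟨lev (i - 1) - 1, by omega, by omega, by omega⟩
    · exact absurd h3 hwest
    · exact ⟨lev (i - 1) + 1, by omega, by omega, by omega⟩
  have hdk : dir k = (1, 0) := by simp [dir, hk]
  -- By minimality of `e` the axis is free up to (-1, 0). The extension is empty if `e = 1`.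
  obtain ⟨u', lev', hp, -, hl, hu', hl'⟩ := hpath.extend h1 h2 (e - 1) (by
    intro s hs hs' j hj
    have := hmin (e - s) (by omega) (by omega) j (by omega)
    rw [hui, hdk]
    convert this using 1
    ext <;> simp
    omega)
  have hk8 : k % 8 = 4 := by
    refine hp.level_of_end ?_ hk ?_ ?_
    · rw [hu', hui, hdk]
      ext <;> simp
      omega
    all_goals
      rcases Nat.eq_zero_or_pos (e - 1) with h0 | h0
      · rw [h0, add_zero, hl _ (by omega)]
        assumption
      · rw [show i + (e - 1) - 1 = i + (e - 2) by omega, hl']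
        omega
  exact ⟨i - 1, by omega, by omega⟩

end LatticePath

/-! ### From realizations to lattice paths, and the resulting distances -/

theorem net_take_succ {σ : List Turn} {m : ℕ} (hm : m < σ.length) :
    net (σ.take (m + 1)) ≤ net (σ.take m) + 1 ∧ net (σ.take m) ≤ net (σ.take (m + 1)) + 1 := by
  rw [List.take_succ_eq_append_getElem hm, net_append]
  cases σ[m] <;> (simp; try omega)

/-- Each segment is subdivided into unit steps. Remembering a segment that contains each vertex lets
the simplicity of the chain yield the injectivity of the path. -/
theorem IsRealization.exists_latticePath {σ : List Turn} {v : ℕ → ℤ × ℤ} (h : IsRealization σ v)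
    (m : ℕ) (hm : m ≤ σ.length) : ∃ N u lev, LatticePath N u lev ∧ u N = v (m + 1) ∧
      lev (N - 1) = net (σ.take m) ∧ (∀ i < N, ∃ n, lev i = net (σ.take n)) ∧
      ∀ i ≤ N, ∃ n ≤ m, u i ∈ Set.uIcc (v n) (v (n + 1)) := by
  induction m with
  | zero =>
    obtain ⟨t, ht, hv⟩ := h.step 0 hm
    rw [heading_eq, h.start] at hv
    have hv1 : v 1 = ((t : ℤ), (0 : ℤ)) := by simpa [dir] using hv
    refine ⟨t, fun i => ((i : ℤ), 0), fun _ => 0, ⟨ht, rfl, rfl, ?_, ?_, ?_⟩, hv1.symm, rfl,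
      fun i _ => ⟨0, rfl⟩, fun i hi => ⟨0, le_rfl, ?_⟩⟩
    · intro i _; simp [dir]
    · intro i _; simp
    · intro i j hij _ he
      have := congrArg Prod.fst he
      simp at this
      omega
    · rw [h.start, zero_add, hv1, mem_uIcc_prod]
      simp only
      omega
  | succ m ih =>
    obtain ⟨N, u, lev, hp, hend, hlast, hlev, hmem⟩ := ih (by omega)
    obtain ⟨t, ht, hv⟩ := h.step (m + 1) hm
    rw [heading_eq] at hv
    have hturn := net_take_succ (σ := σ) (m := m) (by omega)
    have hspec := dir_spec (net (σ.take (m + 1)))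
    generalize hk : net (σ.take (m + 1)) = k at hv hturn hspec
    have hseg : ∀ s : ℕ, s ≤ t → u N + (s : ℤ) • dir k ∈ Set.uIcc (v (m + 1)) (v (m + 1 + 1)) := by
      intro s hs
      rw [hend, hv, mem_uIcc_prod]
      simp only [Prod.fst_add, Prod.snd_add, Prod.smul_fst, Prod.smul_snd, smul_eq_mul]
      rcases hspec with ⟨-, h1, h2⟩ | ⟨-, h1, h2⟩ | ⟨-, h1, h2⟩ | ⟨-, h1, h2⟩ <;> rw [h1, h2] <;>
        omega
    obtain ⟨u', lev', hp', hu, hl, hu', hl'⟩ := hp.extend (k := k) (by omega) (by omega) t (by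
      intro s hs hst i hi he
      obtain ⟨n, hn, hin⟩ := hmem i hi
      have hs' := hseg s hst
      rw [he] at hin
      rcases Nat.lt_or_ge n m with hnm | hnm
      · exact Set.disjoint_left.1 (h.nonadjacent n (m + 1) (by omega) hm) hin hs'
      · obtain rfl : n = m := by omega
        have := (h.adjacent n (by omega)).subset ⟨hin, hs'⟩
        rw [Set.mem_singleton_iff, hend] at this
        have h1 := congrArg Prod.fst this
        have h2 := congrArg Prod.snd this
        simp only [Prod.fst_add, Prod.snd_add, Prod.smul_fst, Prod.smul_snd, smul_eq_mul] at h1 h2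
        rcases hspec with ⟨-, h3, h4⟩ | ⟨-, h3, h4⟩ | ⟨-, h3, h4⟩ | ⟨-, h3, h4⟩ <;>
          rw [h3] at h1 <;> rw [h4] at h2 <;> omega)
    refine ⟨N + t, u', lev', hp', ?_, ?_, ?_, ?_⟩
    · rw [hu', hv, hend]
    · rw [show N + t - 1 = N + (t - 1) by omega, hl']
    · intro i hi
      rcases Nat.lt_or_ge i N with hiN | hiN
      · rw [hl i hiN]; exact hlev i hiN
      · obtain ⟨s, rfl⟩ := Nat.exists_eq_add_of_le hiN
        exact ⟨m + 1, by rw [hl', hk]⟩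
    · intro i hi
      rcases le_or_gt i N with hiN | hiN
      · rw [hu i hiN]
        obtain ⟨n, hn, hin⟩ := hmem i hiN
        exact ⟨n, by omega, hin⟩
      · obtain ⟨s, rfl⟩ := Nat.exists_eq_add_of_le hiN.le
        rw [hu']
        exact ⟨m + 1, le_rfl, hseg s (by omega)⟩

/-- A word that reaches the negative `x`-axis visits level `3` or level `-3`. -/
theorem exists_visit {σ : List Turn} {d : ℕ} (h : d ∈ negXDistances σ) :
    ∃ u v, σ = u ++ v ∧ (net u = 3 ∨ net u = -3) := by
  obtain ⟨hd, v, hv, hend⟩ := h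
  obtain ⟨N, u, lev, hp, hu, -, hlev, -⟩ := hv.exists_latticePath σ.length le_rfl
  obtain ⟨i, hi, h3⟩ := hp.exists_level hd (hu.trans hend)
  obtain ⟨n, hn⟩ := hlev i hi
  rw [hn] at h3
  rcases h3 with h3 | h3
  · obtain ⟨a, b, hab, ha⟩ := exists_split (by norm_num) h3
    exact ⟨a, b ++ σ.drop n, by rw [← List.append_assoc, ← hab, List.take_append_drop], Or.inl ha⟩
  · obtain ⟨a, b, hab, ha⟩ := exists_split (w := (σ.take n).map flip) (n := 3) (by norm_num)
      (by rw [net_map_flip]; omega)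
    have hab' := congrArg (List.map flip) hab
    rw [map_flip_flip, List.map_append] at hab'
    exact ⟨a.map flip, b.map flip ++ σ.drop n,
      by rw [← List.append_assoc, ← hab', List.take_append_drop], Or.inr (by simp [ha])⟩

theorem mem_negXDistances_of_three_le {σ : List Turn} {k : ℕ} (hk : net σ = k) (h3 : 3 ≤ k)
    (h2 : k % 4 ≠ 2) : (k + 2) / 4 ∈ negXDistances σ := by
  obtain h | h | h : k % 4 = 3 ∨ k % 4 = 0 ∨ k % 4 = 1 := by omega
  · have := draws_south_of_net ((k - 3) / 4) (w := σ) (by omega) le_rfl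
    refine mem_negXDistances (by omega) (this.congr rfl (Prod.ext ?_ rfl) fun _ _ h => h)
    simp only
    omega
  · have := draws_east_of_net ((k - 4) / 4) (w := σ) (by omega)
    refine mem_negXDistances (by omega) (this.congr rfl (Prod.ext ?_ rfl) fun _ _ h => h)
    simp only
    omega
  · have := draws_north_of_net ((k - 5) / 4) (w := σ) (by omega)
    refine mem_negXDistances (by omega) (this.congr rfl (Prod.ext ?_ rfl) fun _ _ h => h)
    simp only
    omega

/-- Arrival from above and a final right turn. -/
theorem mem_negXDistances_concat_R {σ : List Turn} {k : ℕ} (hk : net (σ ++ [R]) = k)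
    (h2 : k % 4 = 2) : (k + 2) / 4 + 1 ∈ negXDistances (σ ++ [R]) := by
  rw [net_append, net_cons_R, net_nil] at hk
  have := draws_south_of_net ((k - 2) / 4) (w := σ) (by omega) le_rfl
  refine mem_negXDistances_concat (t := R) (d := (k + 2) / 4) (this.congr rfl (Prod.ext ?_ rfl) ?_) rfl
  · simp only
    omega
  · intro p q h
    simp only [Set.mem_ofPred_eq] at h ⊢
    omega

/-- Arrival from below and a final left turn. -/
theorem mem_negXDistances_concat_L {σ : List Turn} {k : ℕ} (hk : net (σ ++ [L]) = k)
    (h2 : k % 4 = 2) (h3 : 3 ≤ k) : (k + 2) / 4 ∈ negXDistances (σ ++ [L]) := by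
  rw [net_append, net_cons_L, net_nil] at hk
  have := draws_north_of_net ((k - 6) / 4) (w := σ) (by omega)
  rw [show (k + 2) / 4 = (k - 6) / 4 + 1 + 1 by omega]
  refine mem_negXDistances_concat (t := L) (d := (k - 6) / 4 + 1) (this.congr rfl (Prod.ext ?_ rfl) ?_) rfl
  · simp only
    omega
  · intro p q h
    simp only [Set.mem_ofPred_eq] at h ⊢
    omega

end Turn

theorem theorem3 (σ : List Turn) (l r : ℕ) (hl : σ.count Turn.L = l) (hr : σ.count Turn.R = r)
    (hlr : r ≤ l) :
    (3 ≤ l - r → (Turn.negXDistances σ).Nonempty) ∧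
    ∀ d : ℕ, IsLeast (Turn.negXDistances σ) d →
      (l - r = 0 → d ≤ 2) ∧
      (l - r = 1 → d ≤ Turn.nwStaircaseCount σ + 1) ∧
      (l - r = 2 →
        (σ.getLast? = some Turn.R → d ≤ 2) ∧
        (σ.getLast? = some Turn.L → d ≤ Turn.nwStaircaseCount σ + 2)) ∧
      (3 ≤ l - r →
        ((σ.getLast? = some Turn.R ∧ l - r ≡ 2 [MOD 4]) → d ≤ (l - r + 2) / 4 + 1) ∧
        (¬ (σ.getLast? = some Turn.R ∧ l - r ≡ 2 [MOD 4]) → d ≤ (l - r + 2) / 4)) := by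
  obtain ⟨k, hk⟩ : ∃ k, k = l - r := ⟨_, rfl⟩
  have hnet : Turn.net σ = k := by
    unfold Turn.net
    omega
  rw [← hk]
  have hlast : ∀ t, σ.getLast? = some t → ∃ w, σ = w ++ [t] := fun t ht => by
    obtain ⟨w, hw⟩ := List.getLast?_eq_some_iff.1 ht
    exact ⟨w, hw⟩
  have hR : 3 ≤ k → σ.getLast? = some Turn.R ∧ k ≡ 2 [MOD 4] →
      (k + 2) / 4 + 1 ∈ Turn.negXDistances σ := by
    rintro - ⟨ht, h2⟩
    obtain ⟨w, rfl⟩ := hlast _ ht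
    exact Turn.mem_negXDistances_concat_R hnet h2
  have hL : 3 ≤ k → ¬ (σ.getLast? = some Turn.R ∧ k ≡ 2 [MOD 4]) →
      (k + 2) / 4 ∈ Turn.negXDistances σ := by
    intro h3 hn
    by_cases h2 : k % 4 = 2
    · rcases List.eq_nil_or_concat' σ with rfl | ⟨w, t, rfl⟩
      · simp at hnet
        omega
      · cases t with
        | L => exact Turn.mem_negXDistances_concat_L hnet h2 h3
        | R => exact absurd ⟨by simp, h2⟩ hn
    · exact Turn.mem_negXDistances_of_three_le hnet h3 h2
  refine ⟨fun h3 => ?_, fun d hd => ⟨fun h0 => ?_, fun h1 => ?_, fun h2 => ⟨fun ht => ?_, fun ht => ?_⟩,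
    fun h3 => ⟨fun h => hd.2 (hR h3 h), fun h => hd.2 (hL h3 h)⟩⟩⟩
  · by_cases h : σ.getLast? = some Turn.R ∧ k ≡ 2 [MOD 4]
    · exact ⟨_, hR h3 h⟩
    · exact ⟨_, hL h3 h⟩
  · exact hd.2 (Turn.mem_negXDistances two_pos (Turn.draws_of_net_zero (by rw [hnet, h0]; rfl)
      (Turn.exists_visit hd.1) (m := 0) (k := 0) (by norm_num) le_rfl))
  · obtain ⟨e, he, hle, h⟩ :=
      Turn.draws_of_net_one (by rw [hnet, h1]; rfl) (Turn.exists_visit hd.1)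
    exact (hd.2 (Turn.mem_negXDistances he h)).trans hle
  · obtain ⟨w, rfl⟩ := hlast _ ht
    subst h2
    exact hd.2 (Turn.mem_negXDistances_concat_R hnet rfl)
  · obtain ⟨w, rfl⟩ := hlast _ ht
    have hw : Turn.net w = 1 := by
      simp at hnet
      omega
    have hvis : ∃ u v, w = u ++ v ∧ (Turn.net u = 3 ∨ Turn.net u = -3) := by
      obtain ⟨u, v, huv, hu⟩ := Turn.exists_visit hd.1
      rcases List.eq_nil_or_concat' v with rfl | ⟨v, t, rfl⟩
      · rw [List.append_nil] at huv
        rw [← huv] at hu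
        omega
      · rw [← List.append_assoc] at huv
        exact ⟨u, v, (List.append_inj' huv rfl).1, hu⟩
    obtain ⟨e, he, hle, h⟩ := Turn.draws_of_net_one hw hvis
    -- The added segment heads west, so it prolongs the staircase without adding a north segment.
    have hcount : Turn.nwStaircaseCount (w ++ [Turn.L]) = Turn.nwStaircaseCount w := by
      rw [Turn.nwStaircaseCount_concat, hnet, h2]
      simp [Turn.dir]
    have := hd.2 (Turn.mem_negXDistances_concat h (t := Turn.L) rfl)
    omega
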